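/- Let $\varphi(\xi)=\xi/(1+\xi^2)$ and, for $t\in\mathbb{R}$, let $S(t)=e^{-it\varphi(D)}$, $D=-i\partial_x$, be the group of the linear BBM equation on the line, i.e. the Fourier multiplier on $\mathscr{S}'(\mathbb{R})$ given by $\widehat{S(t)f}(\xi)=e^{-it\varphi(\xi)}\widehat f(\xi)$ (with $\widehat f(\xi)=\int e^{-ix\xi}f(x)\,dx$ for $f\in\mathscr{S}(\mathbb{R})$). Fix a smooth function $\rho:\mathbb{R}\to[0,1]$ with $\rho(\xi)=1$ for $|\xi|\le\frac12$ and $\rho(\xi)=0$ for $|\xi|\ge1$, and put, for $k\in\mathbb{Z}$, $$\sigma_k(\xi)=\rho(\xi-k)\Big(\sum_{l\in\mathbb{Z}}\rho(\xi-l)\Big)^{-1},\qquad \square_k=\mathscr{F}^{-1}\sigma_k\mathscr{F}.$$ For $s\in\mathbb{R}$, $1\le p\le\infty$, $0<q<\infty$ and $f\in\mathscr{S}'(\mathbb{R})$ let $$\|f\|_{M^s_{p,q}}=\Big(\sum_{k\in\mathbb{Z}}(1+|k|)^{sq}\|\square_kf\|_{L^p}^q\Big)^{1/q}\in[0,\infty]$$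 (with $\|g\|_{L^p}=\infty$ if $g\in\mathscr{S}'(\mathbb{R})$ is not in $L^p$), and let $M^s_{p,q}$ be the space of those $f$ for which this is finite. For $\sigma<-1$ let $$\beta_\sigma=\begin{cases}\dfrac{\sigma+1}{1-2\sigma},&-4\le\sigma<-1,\\[2mm] \dfrac{-3}{1-2\sigma},&\sigma\le-4.\end{cases}$$ Let $s\in\mathbb{R}$, $\sigma<-1$, $2\le p<\infty$, $\frac1p+\frac1{p'}=1$, $0<q<\infty$ and $\theta\in[0,1]$. Then there is a constant $C$, depending only on $\rho,s,\sigma,p,q,\theta$, such that for all $t\in\mathbb{R}$ and all $f\in M^{s-\sigma\theta}_{p',q}$ one has $S(t)f\in M^s_{p,q}$ and $$\|S(t)f\|_{M^s_{p,q}}\le C\,(1+|t|)^{2\theta\left(\frac12-\frac1p\right)\beta_\sigma}\,\|f\|_{M^{s-\sigma\theta}_{p',q}}.$$ -/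

import Mathlib

open scoped SchwartzMap ENNReal NNReal ContDiff
open MeasureTheory

noncomputable section

namespace BBM

/-- The multiplier operator `m(D)`, `D = -i ∂ₓ`, on tempered distributions on the real line. Here
`m` is a function of the angular frequency (the variable dual to `x` through `e^{i x ξ}`); Mathlib's
Fourier transform is built on `e^{-2 π i x ξ}`, so its frequency `ξ` is the angular frequency
`2 π ξ`. -/
def multiplier (m : ℝ → ℂ) : 𝓢'(ℝ, ℂ) →L[ℂ] 𝓢'(ℝ, ℂ) :=
  TemperedDistribution.fourierMultiplierCLM ℂ (fun ξ : ℝ => m (2 * Real.pi * ξ))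

/-- The symbol `φ(ξ) = ξ / (1 + ξ²)`. -/
def phi (ξ : ℝ) : ℝ := ξ / (1 + ξ ^ 2)

/-- The BBM group `S(t) = e^{-i t φ(D)}`. -/
def group (t : ℝ) : 𝓢'(ℝ, ℂ) →L[ℂ] 𝓢'(ℝ, ℂ) :=
  multiplier (fun ξ => Complex.exp (-(Complex.I * (t * phi ξ : ℝ))))

/-- The smooth cut-off functions `ρ : ℝ → [0, 1]` from which the frequency-uniform decomposition is
built. -/
structure IsCutoff (ρ : ℝ → ℝ) : Prop where
  smooth : ContDiff ℝ ∞ ρ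
  mem_Icc : ∀ ξ, ρ ξ ∈ Set.Icc (0 : ℝ) 1
  eq_one : ∀ ξ, |ξ| ≤ 1 / 2 → ρ ξ = 1
  eq_zero : ∀ ξ, 1 ≤ |ξ| → ρ ξ = 0

/-- `σ_k(ξ) = ρ(ξ - k) / ∑_l ρ(ξ - l)`. -/
def sigma (ρ : ℝ → ℝ) (k : ℤ) (ξ : ℝ) : ℝ := ρ (ξ - k) * (∑' l : ℤ, ρ (ξ - l))⁻¹

/-- The frequency-uniform decomposition operators `□_k = 𝓕⁻¹ σ_k 𝓕`. -/
def box (ρ : ℝ → ℝ) (k : ℤ) : 𝓢'(ℝ, ℂ) →L[ℂ] 𝓢'(ℝ, ℂ) :=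
  multiplier (fun ξ => (sigma ρ k ξ : ℂ))

/-- The `L^p` norm, `1 ≤ p ≤ ∞`, of a tempered distribution: the norm of the `L^p` function that
represents it, and `∞` if there is none. -/
def lpNorm (p : ℝ≥0∞) (f : 𝓢'(ℝ, ℂ)) : ℝ≥0∞ :=
  ⨅ (g : ℝ → ℂ) (_ : MemLp g p volume) (_ : ∀ u : 𝓢(ℝ, ℂ), f u = ∫ x, u x * g x),
    eLpNorm g p volume

/-- The (quasi-)norm of the modulation space `M^s_{p,q}`, `1 ≤ p ≤ ∞`, `0 < q < ∞`, with value `∞`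
exactly at the tempered distributions outside `M^s_{p,q}`. -/
def modNorm (ρ : ℝ → ℝ) (s : ℝ) (p : ℝ≥0∞) (q : ℝ) (f : 𝓢'(ℝ, ℂ)) : ℝ≥0∞ :=
  (∑' k : ℤ, ENNReal.ofReal ((1 + |(k : ℝ)|) ^ (s * q)) * lpNorm p (box ρ k f) ^ q) ^ (1 / q)

/-- The decay exponent `β_σ`, used for `σ < -1`. -/
def beta (σ : ℝ) : ℝ :=
  if -4 ≤ σ then (σ + 1) / (1 - 2 * σ) else -3 / (1 - 2 * σ)

end BBM

end

/-!
The symbol of `□_k S(t)` is the Schwartz function `e^{-itφ} σ_k`, supported in a frequency window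
of length two around `k`. Its kernel is an oscillatory integral whose phase degenerates only at the
three zeros of `φ''`; there `|φ''|` vanishes linearly, while `|φ''| ≳ |k|⁻³` at infinity. Cutting
out `δ`-neighbourhoods of these zeros and applying van der Corput's second derivative test elsewhere
bounds the kernel by a multiple of `δ` as soon as `(1 + |k|)⁴ ≤ |t| δ³`. Hence the kernel is
`O(((1 + |k|)⁴ / (1 + |t|))^τ)` for all `τ ∈ [0, 1/3]`, the case `τ = 0` being trivial.

This is the `L¹ → L^∞` bound of each block. The `L² → L²` bound is Plancherel's theorem, and complex
interpolation of the bilinear form `(f, g) ↦ ⟨m(D) f, g⟩` between the two gives `L^{p'} → L^p` with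
the power `1 - 2/p` of the kernel bound. Since `□_k S(t) = ∑_{|j| ≤ 1} □_k S(t) □_{k + j}`, summing
over `k` costs `4τ(1 - 2/p)` derivatives and gains `(1 + |t|)^{-τ(1 - 2/p)}`. For `σ ≤ 0` the choice
`τ = -θ max(-1/3, σ/4)` uses at most `-σθ` derivatives, and `max(-1/3, σ/4) ≤ β_σ`.
-/

section Interpolation

/-- The complex power `sgn(a) |a| ^ w` of the modulus of `a`, with the phase of `a` kept; as a
function of `w` it is the analytic family through `a` used in complex interpolation. -/
noncomputable def polarPower (w a : ℂ) : ℂ :=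
  a / (‖a‖ : ℂ) * Complex.exp ((Real.log ‖a‖ : ℂ) * w)

theorem polarPower_zero (w : ℂ) : polarPower w 0 = 0 := by
  simp [polarPower]

theorem polarPower_one_left (a : ℂ) : polarPower 1 a = a := by
  rcases eq_or_ne a 0 with rfl | ha
  · exact polarPower_zero 1
  · have ha' : 0 < ‖a‖ := norm_pos_iff.2 ha
    rw [polarPower, mul_one, ← Complex.ofReal_exp, Real.exp_log ha', div_mul_cancel₀]
    exact_mod_cast ha'.ne'

theorem differentiable_polarPower (a : ℂ) : Differentiable ℂ fun w => polarPower w a := by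
  unfold polarPower
  fun_prop

theorem norm_polarPower {w : ℂ} (hw : w.re ≠ 0) (a : ℂ) : ‖polarPower w a‖ = ‖a‖ ^ w.re := by
  rcases eq_or_ne a 0 with rfl | ha
  · simp [polarPower_zero, Real.zero_rpow hw]
  · have ha' : 0 < ‖a‖ := norm_pos_iff.2 ha
    rw [polarPower, norm_mul, Complex.norm_exp, Complex.re_ofReal_mul, norm_div, Complex.norm_real,
      norm_norm, div_self ha'.ne', one_mul, Real.rpow_def_of_pos ha']

theorem norm_polarPower_le (w a : ℂ) : ‖polarPower w a‖ ≤ Real.exp (|Real.log ‖a‖| * |w.re|) := by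
  have hphase : ‖a / (‖a‖ : ℂ)‖ ≤ 1 := by
    rw [norm_div, Complex.norm_real, norm_norm]
    exact div_self_le_one _
  rw [polarPower, norm_mul, Complex.norm_exp, Complex.re_ofReal_mul, ← abs_mul]
  exact (mul_le_of_le_one_left (Real.exp_pos _).le hphase).trans
    (Real.exp_le_exp.2 (le_abs_self _))

variable {α β : Type*} [MeasurableSpace α] [MeasurableSpace β] {μ : Measure α} {ν : Measure β}

theorem lpNorm_eq_rpow_of_norm_eq {E F : Type*} [NormedAddCommGroup E] [NormedAddCommGroup F]
    {f : α → E} {g : α → F} (hf : AEStronglyMeasurable f μ) (hg : AEStronglyMeasurable g μ)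
    {q r : ℝ} (hq : 0 < q) (hr : 0 < r) (h : ∀ x, ‖g x‖ = ‖f x‖ ^ (r / q)) :
    lpNorm g (.ofReal q) μ = lpNorm f (.ofReal r) μ ^ (r / q) := by
  have hnorm : eLpNorm g (.ofReal q) μ = eLpNorm (fun x => ‖f x‖ ^ (r / q)) (.ofReal q) μ :=
    eLpNorm_congr_norm_ae (.of_forall fun x => by
      rw [h, Real.norm_of_nonneg (by positivity)])
  rw [← toReal_eLpNorm hg, ← toReal_eLpNorm hf, hnorm, eLpNorm_norm_rpow _ (by positivity),
    ENNReal.toReal_rpow, ← ENNReal.ofReal_mul hq.le, mul_div_cancel₀ _ hq.ne']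

theorem norm_toL1_eq_lpNorm {E : Type*} [NormedAddCommGroup E] {f : α → E} (hf : Integrable f μ) :
    ‖hf.toL1‖ = lpNorm f 1 μ := by
  rw [Integrable.norm_toL1_eq_lintegral_enorm, ← eLpNorm_one_eq_lintegral_enorm,
    toReal_eLpNorm hf.aestronglyMeasurable]

theorem integrable_simpleFunc_map {E : Type*} [NormedAddCommGroup E] {f : SimpleFunc α E}
    (hf : Integrable f μ) {h : E → ℂ} (h0 : h 0 = 0) : Integrable (f.map h) μ :=
  SimpleFunc.integrable_iff_finMeasSupp.2 ((SimpleFunc.integrable_iff_finMeasSupp.1 hf).map h0)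

theorem exists_toL1_map_eq_sum {E : Type*} [NormedAddCommGroup E] {f : SimpleFunc α E}
    (hf : Integrable f μ) : ∃ e : E → Lp ℂ 1 μ, ∀ (h : E → ℂ) (h0 : h 0 = 0),
      (integrable_simpleFunc_map hf h0).toL1 = ∑ c ∈ f.range, h c • e c := by
  classical
  have hind (c : E) : Integrable (f.map fun a => if a = c ∧ c ≠ 0 then (1 : ℂ) else 0) μ :=
    integrable_simpleFunc_map hf (by aesop)
  refine ⟨fun c => (hind c).toL1, fun h h0 => Lp.ext ?_⟩
  have hcoe : ∀ᵐ x ∂μ, ∀ c ∈ f.range,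
      (h c • (hind c).toL1) x = h c * if f x = c ∧ c ≠ 0 then 1 else 0 := by
    refine (ae_ball_iff f.range.countable_toSet).2 fun c _ => ?_
    filter_upwards [Lp.coeFn_smul (h c) (hind c).toL1, (hind c).coeFn_toL1] with x h₁ h₂
    rw [h₁, Pi.smul_apply, h₂, smul_eq_mul]
    rfl
  filter_upwards [(integrable_simpleFunc_map hf h0).coeFn_toL1, hcoe,
    Lp.coeFn_finsetSum f.range fun c => h c • (hind c).toL1] with x h₁ h₂ h₃
  rw [h₁, h₃, Finset.sum_apply, Finset.sum_congr rfl h₂, SimpleFunc.map_apply,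
    Finset.sum_eq_single_of_mem (f x) (f.mem_range_self x) fun c _ hc => by simp [hc.symm]]
  by_cases hx : f x = 0 <;> simp [hx, h0]

/-- The `L¹` class of the simple function `f` with its values raised to the power `w` by
`polarPower`. -/
noncomputable def polarPowerL1 {f : SimpleFunc α ℂ} (hf : Integrable f μ) (w : ℂ) : Lp ℂ 1 μ :=
  (integrable_simpleFunc_map hf (polarPower_zero w)).toL1

theorem polarPowerL1_one {f : SimpleFunc α ℂ} (hf : Integrable f μ) :
    polarPowerL1 hf 1 = hf.toL1 := by
  simp only [polarPowerL1, SimpleFunc.coe_map, Function.comp_def, polarPower_one_left]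

theorem differentiable_polarPowerL1 {f : SimpleFunc α ℂ} (hf : Integrable f μ) :
    Differentiable ℂ (polarPowerL1 hf) := by
  obtain ⟨e, he⟩ := exists_toL1_map_eq_sum hf
  have : polarPowerL1 hf = fun w => ∑ c ∈ f.range, polarPower w c • e c :=
    funext fun w => he _ (polarPower_zero w)
  rw [this]
  exact .fun_sum fun c _ => (differentiable_polarPower c).smul_const _

theorem exists_norm_polarPowerL1_le {f : SimpleFunc α ℂ} (hf : Integrable f μ) (R : ℝ) :
    ∃ K, ∀ w : ℂ, |w.re| ≤ R → ‖polarPowerL1 hf w‖ ≤ K := by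
  obtain ⟨e, he⟩ := exists_toL1_map_eq_sum hf
  refine ⟨∑ c ∈ f.range, Real.exp (|Real.log ‖c‖| * R) * ‖e c‖, fun w hw => ?_⟩
  rw [polarPowerL1, he _ (polarPower_zero w)]
  refine norm_sum_le_of_le _ fun c _ => ?_
  rw [norm_smul]
  gcongr
  exact (norm_polarPower_le w c).trans (by gcongr)

theorem lpNorm_map_polarPower (f : SimpleFunc α ℂ) {q r : ℝ} {w : ℂ} (hq : 0 < q) (hr : 0 < r)
    (hw : w.re = r / q) :
    lpNorm (f.map (polarPower w)) (.ofReal q) μ = lpNorm f (.ofReal r) μ ^ (r / q) :=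
  lpNorm_eq_rpow_of_norm_eq f.aestronglyMeasurable
    (f.map (polarPower w)).aestronglyMeasurable hq hr fun x => by
      rw [SimpleFunc.map_apply, norm_polarPower (hw ▸ (div_pos hr hq).ne'), hw]

theorem norm_polarPowerL1 {f : SimpleFunc α ℂ} (hf : Integrable f μ) {r : ℝ} {w : ℂ} (hr : 0 < r)
    (hw : w.re = r) : ‖polarPowerL1 hf w‖ = lpNorm f (.ofReal r) μ ^ r := by
  rw [polarPowerL1, norm_toL1_eq_lpNorm, ← ENNReal.ofReal_one,
    lpNorm_map_polarPower f one_pos hr (by rw [hw, div_one]), div_one]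

theorem exists_norm_bilin_polarPowerL1_le (B : Lp ℂ 1 μ →L[ℂ] Lp ℂ 1 ν →L[ℂ] ℂ)
    {f : SimpleFunc α ℂ} {g : SimpleFunc β ℂ} (hf : Integrable f μ) (hg : Integrable g ν) (R : ℝ) :
    ∃ K, ∀ w : ℂ, |w.re| ≤ R → ‖B (polarPowerL1 hf w) (polarPowerL1 hg w)‖ ≤ K := by
  obtain ⟨K, hK⟩ := exists_norm_polarPowerL1_le hf R
  obtain ⟨L, hL⟩ := exists_norm_polarPowerL1_le hg R
  exact ⟨‖B‖ * K * L, fun w hw => B.le_of_opNorm₂_le_of_le le_rfl (hK w hw) (hL w hw)⟩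

theorem mul_rpow_interpolate {A M S q r θ : ℝ} (hA : 0 ≤ A) (hM : 0 ≤ M) (hS : 0 ≤ S) (hq : 0 < q)
    (hr : 0 < r) (hθ : θ ∈ Set.Icc 0 1) (hqr : 1 / r = 1 - θ + θ / q) :
    (A * S ^ r) ^ (1 - θ) * (M * S ^ (r / q)) ^ θ = A ^ (1 - θ) * M ^ θ * S := by
  have hexp : r * (1 - θ) + r / q * θ = 1 := by
    rw [div_mul_eq_mul_div, mul_div_assoc, ← mul_add, ← hqr, mul_one_div_cancel hr.ne']
  have hS' : (S ^ r) ^ (1 - θ) * (S ^ (r / q)) ^ θ = S := by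
    rw [← Real.rpow_mul hS, ← Real.rpow_mul hS, ← Real.rpow_add_of_nonneg hS
      (mul_nonneg hr.le (sub_nonneg.2 hθ.2)) (mul_nonneg (by positivity) hθ.1), hexp, Real.rpow_one]
  rw [Real.mul_rpow hA (by positivity), Real.mul_rpow hM (by positivity), mul_mul_mul_comm, hS']

theorem norm_bilin_simpleFunc_le_rpow (B : Lp ℂ 1 μ →L[ℂ] Lp ℂ 1 ν →L[ℂ] ℂ)
    {M q r θ : ℝ} (hM : 0 ≤ M) (hq : 0 < q) (hr : 0 < r) (hθ : θ ∈ Set.Icc 0 1)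
    (hqr : 1 / r = 1 - θ + θ / q)
    (hB : ∀ (f : SimpleFunc α ℂ) (g : SimpleFunc β ℂ) (hf : Integrable f μ) (hg : Integrable g ν),
      ‖B hf.toL1 hg.toL1‖ ≤ M * (lpNorm f (.ofReal q) μ * lpNorm g (.ofReal q) ν))
    {f : SimpleFunc α ℂ} {g : SimpleFunc β ℂ} (hf : Integrable f μ) (hg : Integrable g ν) :
    ‖B hf.toL1 hg.toL1‖ ≤
      ‖B‖ ^ (1 - θ) * M ^ θ * (lpNorm f (.ofReal r) μ * lpNorm g (.ofReal r) ν) := by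
  let w (z : ℂ) : ℂ := r * (1 - z + z / q)
  have hw_re (z : ℂ) : (w z).re = r * (1 - z.re + z.re / q) := by simp [w, Complex.div_ofReal_re]
  have hw_one : w θ = 1 := by
    have : r * (1 - θ + θ / q) = 1 := by rw [← hqr, mul_one_div_cancel hr.ne']
    simp only [w]
    exact_mod_cast this
  let F (z : ℂ) : ℂ := B (polarPowerL1 hf (w z)) (polarPowerL1 hg (w z))
  have hF : Differentiable ℂ F := by
    have hw : Differentiable ℂ w := by fun_prop
    exact (B.differentiable.comp ((differentiable_polarPowerL1 hf).comp hw)).clm_apply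
      ((differentiable_polarPowerL1 hg).comp hw)
  have hbdd : BddAbove ((norm ∘ F) '' Complex.HadamardThreeLines.verticalClosedStrip 0 1) := by
    obtain ⟨K, hK⟩ := exists_norm_bilin_polarPowerL1_le B hf hg (r * (1 + 1 / q))
    refine ⟨K, Set.forall_mem_image.2 fun z ⟨hz0, hz1⟩ => hK _ ?_⟩
    have := sub_nonneg.2 hz1
    rw [hw_re, abs_of_nonneg (by positivity)]
    gcongr
    linarith
  set S := lpNorm f (.ofReal r) μ * lpNorm g (.ofReal r) ν with hS
  have hleft (z : ℂ) (hz : z.re = 0) : ‖F z‖ ≤ ‖B‖ * S ^ r := by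
    have hwz : (w z).re = r := by simp [hw_re, hz]
    rw [hS, Real.mul_rpow lpNorm_nonneg lpNorm_nonneg, ← norm_polarPowerL1 hf hr hwz,
      ← norm_polarPowerL1 hg hr hwz, ← mul_assoc]
    exact B.le_opNorm₂ _ _
  have hright (z : ℂ) (hz : z.re = 1) : ‖F z‖ ≤ M * S ^ (r / q) := by
    have hwz : (w z).re = r / q := by simp [hw_re, hz, div_eq_mul_inv]
    rw [hS, Real.mul_rpow lpNorm_nonneg lpNorm_nonneg, ← lpNorm_map_polarPower f hq hr hwz,
      ← lpNorm_map_polarPower g hq hr hwz]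
    exact hB _ _ _ _
  have key := Complex.HadamardThreeLines.norm_le_interp_of_mem_verticalClosedStrip₀₁' F
    (z := θ) hθ hF.diffContOnCl hbdd hleft hright
  rwa [Complex.ofReal_re, mul_rpow_interpolate (norm_nonneg B) hM
    (mul_nonneg lpNorm_nonneg lpNorm_nonneg) hq hr hθ hqr, show F θ = B hf.toL1 hg.toL1 by
      simp only [F, hw_one, polarPowerL1_one]] at key

theorem exists_seq_simpleFunc_tendsto {f : α → ℂ} {r : ℝ≥0∞} (hf : Integrable f μ) (hr : 1 ≤ r)
    (hr' : r ≠ ⊤) (hfr : MemLp f r μ) :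
    ∃ (F : ℕ → SimpleFunc α ℂ) (hF : ∀ n, Integrable (F n) μ),
      Filter.Tendsto (fun n => (hF n).toL1) .atTop (nhds hf.toL1) ∧
        Filter.Tendsto (fun n => lpNorm (F n) r μ) .atTop (nhds (lpNorm f r μ)) := by
  have : Fact (1 ≤ r) := ⟨hr⟩
  wlog hmeas : StronglyMeasurable f generalizing f
  · have hae := hf.aestronglyMeasurable.ae_eq_mk
    obtain ⟨F, hF, hF₁, hFr⟩ := this (hf.congr hae) (hfr.ae_eq hae)
      hf.aestronglyMeasurable.stronglyMeasurable_mk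
    refine ⟨F, hF, ?_, ?_⟩
    · rwa [(Integrable.toL1_eq_toL1_iff _ _ hf (hf.congr hae)).2 hae]
    · rwa [← toReal_eLpNorm hf.aestronglyMeasurable, eLpNorm_congr_ae hae,
        toReal_eLpNorm hf.aestronglyMeasurable.stronglyMeasurable_mk.aestronglyMeasurable]
  have hF (n : ℕ) :=
    SimpleFunc.memLp_approxOn_range hmeas.measurable (memLp_one_iff_integrable.2 hf) n
  have hFr (n : ℕ) := SimpleFunc.memLp_approxOn_range hmeas.measurable hfr n
  have hnorm := (SimpleFunc.tendsto_approxOn_range_Lp hr' hmeas.measurable hfr).norm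
  refine ⟨_, fun n => memLp_one_iff_integrable.1 (hF n),
    SimpleFunc.tendsto_approxOn_range_Lp ENNReal.one_ne_top hmeas.measurable
      (memLp_one_iff_integrable.2 hf), ?_⟩
  simpa only [Lp.norm_toLp, toReal_eLpNorm hfr.1, toReal_eLpNorm (hFr _).1] using hnorm

theorem norm_bilin_le_rpow_mul_lpNorm (B : Lp ℂ 1 μ →L[ℂ] Lp ℂ 1 ν →L[ℂ] ℂ)
    {M q r θ : ℝ} (hM : 0 ≤ M) (hq : 0 < q) (hr : 1 ≤ r) (hθ : θ ∈ Set.Icc 0 1)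
    (hqr : 1 / r = 1 - θ + θ / q)
    (hB : ∀ (f : SimpleFunc α ℂ) (g : SimpleFunc β ℂ) (hf : Integrable f μ) (hg : Integrable g ν),
      ‖B hf.toL1 hg.toL1‖ ≤ M * (lpNorm f (.ofReal q) μ * lpNorm g (.ofReal q) ν))
    {f : α → ℂ} {g : β → ℂ} (hf : Integrable f μ) (hg : Integrable g ν)
    (hfr : MemLp f (.ofReal r) μ) (hgr : MemLp g (.ofReal r) ν) :
    ‖B hf.toL1 hg.toL1‖ ≤
      ‖B‖ ^ (1 - θ) * M ^ θ * (lpNorm f (.ofReal r) μ * lpNorm g (.ofReal r) ν) := by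
  have hr' : 1 ≤ ENNReal.ofReal r := ENNReal.one_le_ofReal.2 hr
  obtain ⟨F, hF, hF₁, hFr⟩ := exists_seq_simpleFunc_tendsto hf hr' ENNReal.ofReal_ne_top hfr
  obtain ⟨G, hG, hG₁, hGr⟩ := exists_seq_simpleFunc_tendsto hg hr' ENNReal.ofReal_ne_top hgr
  exact le_of_tendsto_of_tendsto'
    (B.continuous₂.tendsto (hf.toL1, hg.toL1) |>.comp (hF₁.prodMk_nhds hG₁)).norm
    ((hFr.mul hGr).const_mul _)
    fun n => norm_bilin_simpleFunc_le_rpow B hM hq (one_pos.trans_le hr) hθ hqr hB (hF n) (hG n)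

end Interpolation

section FourierMultiplierForm

open FourierTransform Convolution
open scoped BoundedContinuousFunction

variable {V : Type*} [NormedAddCommGroup V] [InnerProductSpace ℝ V] [FiniteDimensional ℝ V]
  [MeasurableSpace V] [BorelSpace V]

theorem integrable_mul_boundedContinuousFunction {m : V → ℂ} (hm : Integrable m) (h : V →ᵇ ℂ) :
    Integrable fun ξ => m ξ * h ξ :=
  hm.mul_bdd h.continuous.aestronglyMeasurable (.of_forall h.norm_coe_le_norm)

/-- Integration of bounded continuous functions against the density `m`, as a functional. -/
noncomputable def densityFunctional {m : V → ℂ} (hm : Integrable m) : (V →ᵇ ℂ) →L[ℂ] ℂ :=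
  LinearMap.mkContinuous
    { toFun := fun h => ∫ ξ, m ξ * h ξ
      map_add' := fun h₁ h₂ => by
        simp only [BoundedContinuousFunction.coe_add, Pi.add_apply, mul_add]
        exact integral_add (integrable_mul_boundedContinuousFunction hm h₁)
          (integrable_mul_boundedContinuousFunction hm h₂)
      map_smul' := fun c h => by simp [mul_left_comm, integral_const_mul] }
    (∫ ξ, ‖m ξ‖) fun h => by
      rw [← integral_mul_const]
      refine norm_integral_le_of_norm_le (hm.norm.mul_const _) (.of_forall fun ξ => ?_)
      rw [norm_mul]
      gcongr
      exact h.norm_coe_le_norm ξ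

/-- The bilinear form `(f, g) ↦ ∫ m 𝓕f 𝓕g` on `L¹ × L¹` of the Fourier multiplier `m(D)`: up to the
reflection `x ↦ -x` of `g`, it is `∫ m(D)f · g`. -/
noncomputable def multiplierForm {m : V → ℂ} (hm : Integrable m) :
    Lp ℂ 1 (volume : Measure V) →L[ℂ] Lp ℂ 1 (volume : Measure V) →L[ℂ] ℂ :=
  (ContinuousLinearMap.compL ℂ (V →ᵇ ℂ) (V →ᵇ ℂ) ℂ (densityFunctional hm) ∘L
    ContinuousLinearMap.mul ℂ (V →ᵇ ℂ)).bilinearComp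
      (Real.Lp.fourierTransformCLM V ℂ) (Real.Lp.fourierTransformCLM V ℂ)

theorem multiplierForm_toL1 {m f g : V → ℂ} (hm : Integrable m) (hf : Integrable f)
    (hg : Integrable g) :
    multiplierForm hm hf.toL1 hg.toL1 = ∫ ξ, m ξ * (𝓕 f ξ * 𝓕 g ξ) := by
  have hF {f : V → ℂ} (hf : Integrable f) (ξ : V) :
      Real.Lp.fourierTransform hf.toL1 ξ = 𝓕 f ξ := by
    rw [Real.Lp.fourierTransform_apply, Real.fourier_congr_ae hf.coeFn_toL1]
  simp [multiplierForm, densityFunctional, hF]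

theorem integral_norm_convolution_le {f g : V → ℂ} (hf : Integrable f) (hg : Integrable g) :
    ∫ x, ‖(f ⋆[ContinuousLinearMap.mul ℂ ℂ] g) x‖ ≤ (∫ x, ‖f x‖) * ∫ x, ‖g x‖ := by
  rw [← ContinuousLinearMap.mul_apply' ℝ, ← integral_convolution _ hf.norm hg.norm]
  refine integral_mono (hf.integrable_convolution _ hg).norm
    (hf.norm.integrable_convolution _ hg.norm) fun x => ?_
  refine (norm_integral_le_integral_norm _).trans_eq ?_
  simp [convolution]

theorem integral_mul_fourier {m f : V → ℂ} (hm : Integrable m) (hf : Integrable f) :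
    ∫ ξ, m ξ * 𝓕 f ξ = ∫ x, 𝓕 m x * f x := by
  have := VectorFourier.integral_fourierIntegral_smul_eq_flip (L := innerₗ V)
    Real.continuous_fourierChar continuous_inner hm hf
  simpa using! this.symm

theorem norm_multiplierForm_le {m : V → ℂ} (hm : Integrable m) {A : ℝ} (hA : ∀ x, ‖𝓕 m x‖ ≤ A) :
    ‖multiplierForm hm‖ ≤ A := by
  have hA₀ : 0 ≤ A := (norm_nonneg _).trans (hA 0)
  refine ContinuousLinearMap.opNorm_le_bound₂ _ hA₀ fun F G => ?_
  have hf := L1.integrable_coeFn F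
  have hg := L1.integrable_coeFn G
  have hfg := hf.integrable_convolution (ContinuousLinearMap.mul ℂ ℂ) hg
  calc ‖multiplierForm hm F G‖
      = ‖∫ x, 𝓕 m x * (F ⋆[ContinuousLinearMap.mul ℂ ℂ] G) x‖ := by
        conv_lhs => rw [← Integrable.toL1_coeFn F hf, ← Integrable.toL1_coeFn G hg]
        rw [multiplierForm_toL1, ← integral_mul_fourier hm hfg]
        simp only [Real.fourier_mul_convolution_eq hf hg]
    _ ≤ ∫ x, A * ‖(F ⋆[ContinuousLinearMap.mul ℂ ℂ] G) x‖ := by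
        refine norm_integral_le_of_norm_le (hfg.norm.const_mul A) (.of_forall fun x => ?_)
        rw [norm_mul]
        gcongr
        exact hA x
    _ ≤ A * ((∫ x, ‖F x‖) * ∫ x, ‖G x‖) := by
        rw [integral_const_mul]
        gcongr
        exact integral_norm_convolution_le hf hg
    _ = A * ‖F‖ * ‖G‖ := by rw [L1.norm_eq_integral_norm, L1.norm_eq_integral_norm, mul_assoc]

end FourierMultiplierForm

section Duality

variable {α : Type*} [MeasurableSpace α] {μ : Measure α}

theorem norm_integral_mul_le_lpNorm_mul_lpNorm {p q : ℝ≥0∞} [p.HolderConjugate q] {f g : α → ℂ}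
    (hf : MemLp f p μ) (hg : MemLp g q μ) :
    ‖∫ x, f x * g x ∂μ‖ ≤ lpNorm f p μ * lpNorm g q μ := by
  have hfg : MemLp (f • g) 1 μ := hg.smul hf
  calc ‖∫ x, f x * g x ∂μ‖ ≤ (eLpNorm (f • g) 1 μ).toReal := by
        rw [toReal_eLpNorm hfg.1, lpNorm_one_eq_integral_norm hfg.1]
        exact norm_integral_le_integral_norm _
    _ ≤ (eLpNorm f p μ * eLpNorm g q μ).toReal :=
        ENNReal.toReal_mono (ENNReal.mul_ne_top hf.2.ne hg.2.ne)
          (eLpNorm_smul_le_mul_eLpNorm hg.1 hf.1)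
    _ = lpNorm f p μ * lpNorm g q μ := by
        rw [ENNReal.toReal_mul, toReal_eLpNorm hf.1, toReal_eLpNorm hg.1]

theorem exists_integral_mul_eq_lpNorm_rpow {h : α → ℂ} {p r : ℝ} (hpr : p.HolderConjugate r)
    (hp : MemLp h (.ofReal p) μ) (hp₁ : MemLp h (.ofReal (p - 1)) μ) :
    ∃ g : α → ℂ, Integrable g μ ∧ MemLp g (.ofReal r) μ ∧
      lpNorm g (.ofReal r) μ = lpNorm h (.ofReal p) μ ^ (p - 1) ∧
      ∫ x, h x * g x ∂μ = (lpNorm h (.ofReal p) μ ^ p : ℝ) := by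
  have hp₀ : 0 < p - 1 := hpr.sub_one_pos
  have hexp : p / r = p - 1 := hpr.div_conj_eq_sub_one
  let g : α → ℂ := fun x => starRingEnd ℂ (h x) * (‖h x‖ ^ (p - 2) : ℝ)
  have hg (x : α) : ‖g x‖ = ‖h x‖ ^ (p - 1) := by
    rcases eq_or_ne (h x) 0 with hx | hx
    · simp [g, hx, Real.zero_rpow hp₀.ne']
    · rw [norm_mul, RCLike.norm_conj, Complex.norm_real, Real.norm_of_nonneg (by positivity),
        ← Real.rpow_one_add' (norm_nonneg _) (by linarith)]
      ring_nf
  have hhg (x : α) : h x * g x = (‖h x‖ ^ p : ℝ) := by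
    rw [← mul_assoc, Complex.mul_conj', ← Complex.ofReal_pow, ← Complex.ofReal_mul,
      ← Real.rpow_two, ← Real.rpow_add' (norm_nonneg _) (by linarith [hpr.pos])]
    ring_nf
  have hg_meas : AEStronglyMeasurable g μ := by
    have hconj := (Complex.continuous_conj.comp_aestronglyMeasurable hp.1).aemeasurable
    exact (hconj.mul (hp.1.aemeasurable.norm.pow_const _).complex_ofReal).aestronglyMeasurable
  refine ⟨g, ?_, ?_, ?_, ?_⟩
  · have := hp₁.integrable_norm_rpow (by simpa using hp₀) ENNReal.ofReal_ne_top
    rw [ENNReal.toReal_ofReal hp₀.le] at this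
    exact (integrable_norm_iff hg_meas).1 (by simpa only [hg] using this)
  · rw [← integrable_norm_rpow_iff hg_meas (by simpa using hpr.symm.pos) ENNReal.ofReal_ne_top,
      ENNReal.toReal_ofReal hpr.symm.nonneg]
    have := hp.integrable_norm_rpow (by simpa using hpr.pos) ENNReal.ofReal_ne_top
    rw [ENNReal.toReal_ofReal hpr.nonneg] at this
    simpa only [hg, ← Real.rpow_mul (norm_nonneg _), ← hexp, div_mul_cancel₀ _ hpr.symm.ne_zero]
  · rw [lpNorm_eq_rpow_of_norm_eq hp.1 hg_meas hpr.symm.pos hpr.pos (by simpa only [hexp]), hexp]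
  · simp only [hhg]
    rw [integral_complex_ofReal, lpNorm_eq_integral_norm_rpow_toReal (by simpa using hpr.pos)
      ENNReal.ofReal_ne_top hp.1, ENNReal.toReal_ofReal hpr.nonneg,
      Real.rpow_inv_rpow (by positivity) hpr.ne_zero]

theorem lpNorm_le_of_forall_norm_integral_mul_le {h : α → ℂ} {p r K : ℝ}
    (hpr : p.HolderConjugate r) (hp : MemLp h (.ofReal p) μ) (hp₁ : MemLp h (.ofReal (p - 1)) μ)
    (hK₀ : 0 ≤ K) (hK : ∀ g : α → ℂ, Integrable g μ → MemLp g (.ofReal r) μ →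
      ‖∫ x, h x * g x ∂μ‖ ≤ K * lpNorm g (.ofReal r) μ) :
    lpNorm h (.ofReal p) μ ≤ K := by
  obtain ⟨g, hg, hgr, hg_norm, hhg⟩ := exists_integral_mul_eq_lpNorm_rpow hpr hp hp₁
  set N := lpNorm h (.ofReal p) μ
  have hN : 0 ≤ N := lpNorm_nonneg
  rcases hN.eq_or_lt with hN₀ | hN₀
  · rwa [← hN₀]
  have key : N * N ^ (p - 1) ≤ K * N ^ (p - 1) := by
    have := hK g hg hgr
    rwa [hhg, Complex.norm_real, Real.norm_of_nonneg (by positivity), hg_norm,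
      ← add_sub_cancel 1 p, Real.rpow_one_add' hN (by linarith [hpr.pos]),
      add_sub_cancel] at this
  exact le_of_mul_le_mul_right key (by positivity)

end Duality

section FourierMultiplierLp

open FourierTransform Convolution

variable {V : Type*} [NormedAddCommGroup V] [InnerProductSpace ℝ V] [FiniteDimensional ℝ V]
  [MeasurableSpace V] [BorelSpace V]

theorem fourier_toLp_two_ae_eq {f : V → ℂ} (hf : Integrable f) (hf₂ : MemLp f 2) :
    (𝓕 (hf₂.toLp f) : Lp ℂ 2 (volume : Measure V)) =ᵐ[volume] 𝓕 f := by
  have hcont : Continuous (𝓕 f) :=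
    VectorFourier.fourierIntegral_continuous Real.continuous_fourierChar continuous_inner hf
  refine ae_eq_of_integral_contDiff_smul_eq ((Lp.memLp _).locallyIntegrable one_le_two)
    hcont.locallyIntegrable fun u hu hu_supp => ?_
  have hv_supp : HasCompactSupport fun x => (u x : ℂ) := hu_supp.comp_left Complex.ofReal_zero
  let v : 𝓢(V, ℂ) := hv_supp.toSchwartzMap (Complex.ofRealCLM.contDiff.comp hu)
  have hv : ∫ x, v x • (𝓕 (hf₂.toLp f) : Lp ℂ 2 (volume : Measure V)) x =
      ∫ x, 𝓕 v x • hf₂.toLp f x := by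
    rw [← Lp.toTemperedDistribution_apply, ← Lp.toTemperedDistribution_apply,
      ← Lp.fourier_toTemperedDistribution_eq, TemperedDistribution.fourier_apply]
  refine hv.trans ?_
  calc ∫ x, 𝓕 v x • hf₂.toLp f x = ∫ x, 𝓕 v x * f x := by
        refine integral_congr_ae ?_
        filter_upwards [hf₂.coeFn_toLp] with x hx
        rw [hx, smul_eq_mul]
    _ = ∫ x, v x * 𝓕 f x := (integral_mul_fourier v.integrable hf).symm

theorem memLp_fourier_two {f : V → ℂ} (hf : Integrable f) (hf₂ : MemLp f 2) : MemLp (𝓕 f) 2 :=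
  (memLp_congr_ae (fourier_toLp_two_ae_eq hf hf₂)).1 (Lp.memLp _)

theorem lpNorm_fourier_two {f : V → ℂ} (hf : Integrable f) (hf₂ : MemLp f 2) :
    lpNorm (𝓕 f) 2 volume = lpNorm f 2 volume := by
  rw [← toReal_eLpNorm (memLp_fourier_two hf hf₂).1, ← toReal_eLpNorm hf₂.1,
    ← eLpNorm_congr_ae (fourier_toLp_two_ae_eq hf hf₂), ← Lp.norm_def, Lp.norm_fourier_eq,
    Lp.norm_toLp]

theorem norm_multiplierForm_toL1_le_lpNorm_two {m f g : V → ℂ} (hm : Integrable m) {M : ℝ}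
    (hM : ∀ ξ, ‖m ξ‖ ≤ M) (hf : Integrable f) (hg : Integrable g) (hf₂ : MemLp f 2)
    (hg₂ : MemLp g 2) :
    ‖multiplierForm hm hf.toL1 hg.toL1‖ ≤ M * (lpNorm f 2 volume * lpNorm g 2 volume) := by
  have hM₀ : 0 ≤ M := (norm_nonneg _).trans (hM 0)
  have hF := memLp_fourier_two hf hf₂
  have hG := memLp_fourier_two hg hg₂
  have hmF_le : ∀ᵐ ξ : V, ‖m ξ * 𝓕 f ξ‖ ≤ M * ‖𝓕 f ξ‖ := .of_forall fun ξ => by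
    rw [norm_mul]
    gcongr
    exact hM ξ
  have hmF : MemLp (fun ξ => m ξ * 𝓕 f ξ) 2 := hF.of_le_mul (hm.1.mul hF.1) hmF_le
  have hmF_norm : lpNorm (fun ξ => m ξ * 𝓕 f ξ) 2 volume ≤ M * lpNorm f 2 volume := by
    rw [← lpNorm_fourier_two hf hf₂, ← toReal_eLpNorm hF.1, ← toReal_eLpNorm hmF.1,
      ← ENNReal.toReal_ofReal hM₀, ← ENNReal.toReal_mul]
    exact ENNReal.toReal_mono (ENNReal.mul_ne_top ENNReal.ofReal_ne_top hF.2.ne)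
      (eLpNorm_le_mul_eLpNorm_of_ae_le_mul hmF_le 2)
  calc ‖multiplierForm hm hf.toL1 hg.toL1‖ = ‖∫ ξ, m ξ * 𝓕 f ξ * 𝓕 g ξ‖ := by
        simp only [multiplierForm_toL1, mul_assoc]
    _ ≤ M * lpNorm f 2 volume * lpNorm g 2 volume := by
        refine (norm_integral_mul_le_lpNorm_mul_lpNorm hmF hG).trans ?_
        rw [lpNorm_fourier_two hg hg₂]
        gcongr
        exact lpNorm_nonneg
    _ = M * (lpNorm f 2 volume * lpNorm g 2 volume) := mul_assoc _ _ _

theorem norm_multiplierForm_toL1_le_lpNorm {m f g : V → ℂ} (hm : Integrable m) {A M p r : ℝ}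
    (hA : ∀ x, ‖𝓕 m x‖ ≤ A) (hM : ∀ ξ, ‖m ξ‖ ≤ M) (hp : 2 ≤ p) (hpr : p.HolderConjugate r)
    (hf : Integrable f) (hg : Integrable g) (hfr : MemLp f (.ofReal r))
    (hgr : MemLp g (.ofReal r)) :
    ‖multiplierForm hm hf.toL1 hg.toL1‖ ≤
      A ^ (1 - 2 / p) * M ^ (2 / p) *
        (lpNorm f (.ofReal r) volume * lpNorm g (.ofReal r) volume) := by
  have hM₀ : 0 ≤ M := (norm_nonneg _).trans (hM 0)
  have hp₀ : 0 < p := hpr.pos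
  have hθ : 2 / p ∈ Set.Icc 0 1 := ⟨by positivity, (div_le_one hp₀).2 hp⟩
  have hexp : 1 / r = 1 - 2 / p + 2 / p / 2 := by
    have := hpr.inv_add_inv_eq_one
    field_simp at this ⊢
    linarith
  have h₂ (f : SimpleFunc V ℂ) (hf : Integrable f) : MemLp f 2 :=
    (SimpleFunc.memLp_iff_integrable two_ne_zero ENNReal.ofNat_ne_top).2 hf
  refine (norm_bilin_le_rpow_mul_lpNorm (multiplierForm hm) hM₀ two_pos hpr.symm.lt.le hθ hexp
    (fun f g hf hg => ?_) hf hg hfr hgr).trans ?_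
  · rw [ENNReal.ofReal_ofNat]
    exact norm_multiplierForm_toL1_le_lpNorm_two hm hM hf hg (h₂ f hf) (h₂ g hg)
  · gcongr
    · exact mul_nonneg lpNorm_nonneg lpNorm_nonneg
    · exact sub_nonneg.2 hθ.2
    · exact norm_multiplierForm_le hm hA

theorem integral_fourierMultiplierCLM_mul_eq (m φ : 𝓢(V, ℂ)) {g : V → ℂ} (hg : Integrable g) :
    ∫ x, SchwartzMap.fourierMultiplierCLM ℂ m φ x * g x =
      multiplierForm m.integrable φ.integrable.toL1 hg.comp_neg.toL1 := by
  set ψ := SchwartzMap.smulLeftCLM ℂ m (𝓕 φ) with hψ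
  have hψ_apply (ξ : V) : ψ ξ = m ξ * 𝓕 (φ : V → ℂ) ξ := by
    rw [hψ, SchwartzMap.smulLeftCLM_apply_apply m.hasTemperateGrowth, SchwartzMap.fourier_coe,
      smul_eq_mul]
  calc ∫ x, SchwartzMap.fourierMultiplierCLM ℂ m φ x * g x
      = ∫ x, 𝓕 (ψ : V → ℂ) (-x) * g x := by
        simp only [SchwartzMap.fourierMultiplierCLM_apply, ← hψ, SchwartzMap.fourierInv_coe,
          Real.fourierInv_eq_fourier_neg]
    _ = ∫ x, 𝓕 (ψ : V → ℂ) x * g (-x) := by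
        rw [← integral_neg_eq_self]
        simp only [neg_neg]
    _ = multiplierForm m.integrable φ.integrable.toL1 hg.comp_neg.toL1 := by
        rw [← integral_mul_fourier ψ.integrable hg.comp_neg, multiplierForm_toL1]
        simp only [hψ_apply, mul_assoc]

theorem lpNorm_fourierMultiplierCLM_schwartz_le (m φ : 𝓢(V, ℂ)) {A M p r : ℝ}
    (hA : ∀ x, ‖𝓕 m x‖ ≤ A) (hM : ∀ ξ, ‖m ξ‖ ≤ M) (hp : 2 ≤ p) (hpr : p.HolderConjugate r) :
    lpNorm (SchwartzMap.fourierMultiplierCLM ℂ m φ) (.ofReal p) volume ≤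
      A ^ (1 - 2 / p) * M ^ (2 / p) * lpNorm φ (.ofReal r) volume := by
  have hA₀ : 0 ≤ A := (norm_nonneg _).trans (hA 0)
  have hM₀ : 0 ≤ M := (norm_nonneg _).trans (hM 0)
  have hneg := Measure.measurePreserving_neg (volume : Measure V)
  refine lpNorm_le_of_forall_norm_integral_mul_le hpr (SchwartzMap.memLp _ _ volume)
    (SchwartzMap.memLp _ _ volume) (mul_nonneg (by positivity) lpNorm_nonneg) fun g hg hgr => ?_
  have hgr_neg : lpNorm (fun x => g (-x)) (.ofReal r) volume = lpNorm g (.ofReal r) volume := by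
    rw [← toReal_eLpNorm hgr.1, ← toReal_eLpNorm hg.comp_neg.1,
      ← eLpNorm_comp_measurePreserving hgr.1 hneg]
    rfl
  rw [integral_fourierMultiplierCLM_mul_eq m φ hg, ← hgr_neg, mul_assoc (A ^ _ * M ^ _)]
  exact norm_multiplierForm_toL1_le_lpNorm m.integrable hA hM hp hpr φ.integrable hg.comp_neg
    (φ.memLp _) (hgr.comp_measurePreserving hneg)

end FourierMultiplierLp

section TemperedDistribution

open FourierTransform

variable {V : Type*} [NormedAddCommGroup V] [InnerProductSpace ℝ V] [FiniteDimensional ℝ V]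
  [MeasurableSpace V] [BorelSpace V]

theorem integral_mul_fourierMultiplierCLM (m φ u : 𝓢(V, ℂ)) :
    ∫ x, u x * SchwartzMap.fourierMultiplierCLM ℂ m φ x =
      ∫ x, 𝓕 (SchwartzMap.smulLeftCLM ℂ m (𝓕⁻ u)) x * φ x := by
  have h := congrArg (fun F : 𝓢'(V, ℂ) => F u)
    (TemperedDistribution.fourierMultiplierCLM_toTemperedDistributionCLM_eq m.hasTemperateGrowth φ)
  simpa using h.symm

theorem continuous_integral_mul_Lp {p r : ℝ≥0∞} [p.HolderConjugate r] [Fact (1 ≤ r)] {u : V → ℂ}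
    (hu : MemLp u p) :
    Continuous fun G : Lp ℂ r (volume : Measure V) => ∫ x, u x * G x := by
  have : Fact (1 ≤ p) := ⟨ENNReal.HolderConjugate.one_le p r⟩
  have h := ((ContinuousLinearMap.mul ℂ ℂ).lpPairing volume p r (hu.toLp u)).continuous
  refine h.congr fun G => ?_
  rw [ContinuousLinearMap.lpPairing_eq_integral]
  refine integral_congr_ae ?_
  filter_upwards [hu.coeFn_toLp] with x hx
  rw [hx, ContinuousLinearMap.mul_apply']

theorem exists_Lp_fourierMultiplier (m : 𝓢(V, ℂ)) {A M p r : ℝ} (hA : ∀ x, ‖𝓕 m x‖ ≤ A)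
    (hM : ∀ ξ, ‖m ξ‖ ≤ M) (hp : 2 ≤ p) (hpr : p.HolderConjugate r) [Fact (1 ≤ ENNReal.ofReal p)]
    [Fact (1 ≤ ENNReal.ofReal r)] :
    ∃ T : Lp ℂ (.ofReal r) (volume : Measure V) →L[ℂ] Lp ℂ (.ofReal p) (volume : Measure V),
      (∀ G, ‖T G‖ ≤ A ^ (1 - 2 / p) * M ^ (2 / p) * ‖G‖) ∧ ∀ (u : 𝓢(V, ℂ)) G,
        ∫ x, u x * T G x = ∫ x, 𝓕 (SchwartzMap.smulLeftCLM ℂ m (𝓕⁻ u)) x * G x := by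
  have := hpr.ennrealOfReal
  have := hpr.symm.ennrealOfReal
  let T := (SchwartzMap.toLpCLM ℂ ℂ (.ofReal p) (volume : Measure V)).toLinearMap ∘ₗ
    (SchwartzMap.fourierMultiplierCLM ℂ m).toLinearMap
  let e := (SchwartzMap.toLpCLM ℂ ℂ (.ofReal r) (volume : Measure V)).toLinearMap
  have he : DenseRange e := SchwartzMap.denseRange_toLpCLM ENNReal.ofReal_ne_top
  have hT (φ : 𝓢(V, ℂ)) : ‖T φ‖ ≤ A ^ (1 - 2 / p) * M ^ (2 / p) * ‖e φ‖ := by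
    have hnorm (q : ℝ≥0∞) [Fact (1 ≤ q)] (φ : 𝓢(V, ℂ)) : ‖φ.toLp q‖ = lpNorm φ q volume := by
      rw [SchwartzMap.norm_toLp, toReal_eLpNorm φ.continuous.aestronglyMeasurable]
    have hle := lpNorm_fourierMultiplierCLM_schwartz_le m φ hA hM hp hpr
    rwa [← hnorm, ← hnorm] at hle
  refine ⟨T.extendOfNorm e, LinearMap.norm_extendOfNorm_apply_le he _ hT, fun u G => ?_⟩
  have hcont : Continuous fun G => ∫ x, u x * T.extendOfNorm e G x :=
    (continuous_integral_mul_Lp (u.memLp (.ofReal r) volume)).comp (T.extendOfNorm e).continuous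
  refine congrFun (he.equalizer hcont (continuous_integral_mul_Lp
    ((𝓕 (SchwartzMap.smulLeftCLM ℂ m (𝓕⁻ u))).memLp (.ofReal p) volume)) (funext fun φ => ?_)) G
  calc ∫ x, u x * T.extendOfNorm e (e φ) x
      = ∫ x, u x * SchwartzMap.fourierMultiplierCLM ℂ m φ x := by
        rw [LinearMap.extendOfNorm_eq he ⟨_, hT⟩]
        refine integral_congr_ae ?_
        filter_upwards [(SchwartzMap.fourierMultiplierCLM ℂ m φ).coeFn_toLp (.ofReal p)] with x hx
        exact congrArg _ hx
    _ = ∫ x, 𝓕 (SchwartzMap.smulLeftCLM ℂ m (𝓕⁻ u)) x * e φ x := by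
        rw [integral_mul_fourierMultiplierCLM]
        refine integral_congr_ae ?_
        filter_upwards [φ.coeFn_toLp (.ofReal r)] with x hx
        exact congrArg _ hx.symm

end TemperedDistribution

namespace BBM

section LpNorm

open FourierTransform

theorem lpNorm_le_eLpNorm {p : ℝ≥0∞} {f : 𝓢'(ℝ, ℂ)} {g : ℝ → ℂ} (hg : MemLp g p volume)
    (hfg : ∀ u : 𝓢(ℝ, ℂ), f u = ∫ x, u x * g x) : lpNorm p f ≤ eLpNorm g p volume :=
  iInf₂_le_of_le g hg (iInf_le _ hfg)

theorem lpNorm_zero (p : ℝ≥0∞) : lpNorm p 0 = 0 := by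
  simpa using lpNorm_le_eLpNorm (f := 0) (MemLp.zero (p := p)) (by simp)

theorem lpNorm_add_le {p : ℝ≥0∞} (hp : 1 ≤ p) (f g : 𝓢'(ℝ, ℂ)) :
    lpNorm p (f + g) ≤ lpNorm p f + lpNorm p g := by
  have : p.HolderConjugate (1 - p⁻¹)⁻¹ := .inv_one_sub_inv' hp
  have : ENNReal.HolderConjugate (1 - p⁻¹)⁻¹ p := .symm
  have hint (u : 𝓢(ℝ, ℂ)) {G : ℝ → ℂ} (hG : MemLp G p) : Integrable fun x => u x * G x :=
    (u.memLp (1 - p⁻¹)⁻¹).integrable_mul hG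
  simp only [lpNorm.eq_1 p f, lpNorm.eq_1 p g, ENNReal.iInf_add, ENNReal.add_iInf]
  refine le_iInf fun G => le_iInf fun hG => le_iInf fun hfG => le_iInf fun H => le_iInf fun hH =>
    le_iInf fun hgH => ?_
  refine (lpNorm_le_eLpNorm (hH.add hG) fun u => ?_).trans (eLpNorm_add_le hH.1 hG.1 hp)
  simp only [add_apply, hfG, hgH, Pi.add_apply, mul_add]
  exact (integral_add (hint u hH) (hint u hG)).symm

theorem lpNorm_sum_le {ι : Type*} {p : ℝ≥0∞} (hp : 1 ≤ p) (s : Finset ι) (f : ι → 𝓢'(ℝ, ℂ)) :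
    lpNorm p (∑ i ∈ s, f i) ≤ ∑ i ∈ s, lpNorm p (f i) :=
  Finset.le_sum_of_subadditive _ (lpNorm_zero p).le (lpNorm_add_le hp) s f

theorem lpNorm_fourierMultiplierCLM_le {m : 𝓢(ℝ, ℂ)} {A M p r : ℝ} (hA₀ : 0 < A)
    (hA : ∀ x, ‖𝓕 m x‖ ≤ A) (hM₀ : 0 < M) (hM : ∀ ξ, ‖m ξ‖ ≤ M) (hp : 2 ≤ p)
    (hpr : p.HolderConjugate r) (f : 𝓢'(ℝ, ℂ)) :
    lpNorm (.ofReal p) (TemperedDistribution.fourierMultiplierCLM ℂ m f) ≤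
      .ofReal (A ^ (1 - 2 / p) * M ^ (2 / p)) * lpNorm (.ofReal r) f := by
  have : Fact (1 ≤ ENNReal.ofReal p) := ⟨by simpa using hpr.lt.le⟩
  have : Fact (1 ≤ ENNReal.ofReal r) := ⟨by simpa using hpr.symm.lt.le⟩
  obtain ⟨T, hT, hT_pair⟩ := exists_Lp_fourierMultiplier m hA hM hp hpr
  have hc : 0 < A ^ (1 - 2 / p) * M ^ (2 / p) := by positivity
  simp only [lpNorm.eq_1 (.ofReal r) f,
    ENNReal.mul_iInf_of_ne (ENNReal.ofReal_pos.2 hc).ne' ENNReal.ofReal_ne_top]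
  refine le_iInf fun G => le_iInf fun hG => le_iInf fun hfG => ?_
  refine (lpNorm_le_eLpNorm (Lp.memLp (T (hG.toLp G))) fun u => ?_).trans ?_
  · rw [TemperedDistribution.fourierMultiplierCLM_apply_apply, hfG, hT_pair]
    refine integral_congr_ae ?_
    filter_upwards [hG.coeFn_toLp] with x hx
    rw [hx]
  · rw [← Lp.enorm_def, ← eLpNorm_congr_ae hG.coeFn_toLp, ← Lp.enorm_def, ← ofReal_norm,
      ← ofReal_norm, ← ENNReal.ofReal_mul hc.le]
    exact ENNReal.ofReal_le_ofReal (hT _)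

end LpNorm

end BBM

section OscillatoryIntegral

open Complex

variable {a b : ℝ}

theorem norm_integral_le_of_avoid_point {g : ℝ → ℂ} {z δ B M : ℝ} (hg : Continuous g)
    (hab : a ≤ b) (hδ : 0 ≤ δ) (hM : ∀ x, ‖g x‖ ≤ M) (hB₀ : 0 ≤ B)
    (hB : ∀ a' b', a ≤ a' → a' ≤ b' → b' ≤ b → (∀ x ∈ Set.Icc a' b', δ ≤ |x - z|) →
      ‖∫ x in a'..b', g x‖ ≤ B) :
    ‖∫ x in a..b, g x‖ ≤ 2 * B + 2 * δ * M := by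
  have hi (u v : ℝ) : IntervalIntegrable g volume u v := hg.intervalIntegrable u v
  have hM₀ : 0 ≤ M := (norm_nonneg _).trans (hM a)
  obtain ⟨c, d, hac, hcd, hdb, hlength, hc, hd⟩ : ∃ c d, a ≤ c ∧ c ≤ d ∧ d ≤ b ∧ d - c ≤ 2 * δ ∧
      (a < c → c ≤ z - δ) ∧ (d < b → z + δ ≤ d) :=
    ⟨max a (min b (z - δ)), max a (min b (z + δ)), by grind, by grind, by grind, by grind,
      by grind, by grind⟩
  have hleft : ‖∫ x in a..c, g x‖ ≤ B := by
    rcases hac.eq_or_lt with h | h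
    · rwa [← h, intervalIntegral.integral_same, norm_zero]
    · exact hB a c le_rfl hac (hcd.trans hdb) fun x hx => by
        grind [hc h, hx.2, le_abs_self, neg_le_abs]
  have hright : ‖∫ x in d..b, g x‖ ≤ B := by
    rcases hdb.eq_or_lt with h | h
    · rwa [h, intervalIntegral.integral_same, norm_zero]
    · exact hB d b (hac.trans hcd) hdb le_rfl fun x hx => by grind [hd h, hx.1, le_abs_self]
  have hmiddle : ‖∫ x in c..d, g x‖ ≤ 2 * δ * M := by
    have h := intervalIntegral.norm_integral_le_of_norm_le_const (a := c) (b := d) fun x _ => hM x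
    rw [abs_of_nonneg (sub_nonneg.2 hcd), mul_comm] at h
    exact h.trans (by gcongr)
  rw [← intervalIntegral.integral_add_adjacent_intervals (hi a c) (hi c b),
    ← intervalIntegral.integral_add_adjacent_intervals (hi c d) (hi d b)]
  calc _ ≤ _ := (norm_add_le _ _).trans (add_le_add_right (norm_add_le _ _) _)
    _ ≤ B + (2 * δ * M + B) := by gcongr
    _ = _ := by ring

theorem norm_integral_le_of_avoid_finset {g : ℝ → ℂ} {δ B M : ℝ} (hg : Continuous g)
    (hab : a ≤ b) (hδ : 0 ≤ δ) (hM : ∀ x, ‖g x‖ ≤ M) (hB₀ : 0 ≤ B) (Z : Finset ℝ)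
    (hB : ∀ a' b', a ≤ a' → a' ≤ b' → b' ≤ b → (∀ z ∈ Z, ∀ x ∈ Set.Icc a' b', δ ≤ |x - z|) →
      ‖∫ x in a'..b', g x‖ ≤ B) :
    ‖∫ x in a..b, g x‖ ≤ 2 ^ Z.card * (B + 2 * δ * M) - 2 * δ * M := by
  classical
  have hM₀ : 0 ≤ M := (norm_nonneg _).trans (hM 0)
  induction Z using Finset.induction_on generalizing a b with
  | empty => simpa using hB a b le_rfl hab le_rfl (by simp)
  | insert z Z hz ih =>
    have hone : (1 : ℝ) ≤ 2 ^ Z.card := one_le_pow₀ one_le_two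
    refine (norm_integral_le_of_avoid_point hg hab hδ hM (z := z)
      (B := 2 ^ Z.card * (B + 2 * δ * M) - 2 * δ * M) ?_ fun a' b' ha hab' hb hz' => ?_).trans_eq ?_
    · nlinarith [mul_nonneg hδ hM₀]
    · refine ih hab' fun a'' b'' ha' hab'' hb' hZ => ?_
      refine hB a'' b'' (ha.trans ha') hab'' (hb'.trans hb) (Finset.forall_mem_insert _ _ _ |>.2
        ⟨fun x hx => hz' x (Set.Icc_subset_Icc ha' hb' hx), hZ⟩)
    · rw [Finset.card_insert_of_notMem hz]
      ring

theorem norm_integral_mul_le_of_norm_integral_le {g : ℝ → ℂ} {w w' : ℝ → ℝ} {B : ℝ}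
    (hg : Continuous g) (hab : a ≤ b) (hw : ∀ x ∈ Set.Icc a b, HasDerivAt w (w' x) x)
    (hw' : ContinuousOn w' (Set.Icc a b)) (hB : ∀ x ∈ Set.Icc a b, ‖∫ y in a..x, g y‖ ≤ B) :
    ‖∫ x in a..b, g x * w x‖ ≤ B * (|w b| + ∫ x in a..b, |w' x|) := by
  rw [← Set.uIcc_of_le hab] at hw hw'
  let G : ℝ → ℂ := fun x => ∫ y in a..x, g y
  have hG (x : ℝ) : HasDerivAt G (g x) x := hg.integral_hasStrictDerivAt a x |>.hasDerivAt
  have hw'_int : IntervalIntegrable (fun x => (w' x : ℂ)) volume a b :=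
    (continuous_ofReal.comp_continuousOn hw').intervalIntegrable
  have hparts : ∫ x in a..b, g x * w x = w b * G b - ∫ x in a..b, w' x * G x := by
    simp only [mul_comm (g _)]
    rw [intervalIntegral.integral_mul_deriv_eq_deriv_mul (fun x hx => (hw x hx).ofReal_comp)
      (fun x _ => hG x) hw'_int (hg.intervalIntegrable a b)]
    simp [G]
  have hrem : ‖∫ x in a..b, w' x * G x‖ ≤ B * ∫ x in a..b, |w' x| := by
    rw [← intervalIntegral.integral_const_mul]
    refine intervalIntegral.norm_integral_le_of_norm_le hab (.of_forall fun x hx => ?_)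
      (hw'.abs.intervalIntegrable.const_mul B)
    rw [norm_mul, norm_real, Real.norm_eq_abs, mul_comm]
    exact mul_le_mul_of_nonneg_right (hB x ⟨hx.1.le, hx.2⟩) (abs_nonneg _)
  have hend : ‖w b * G b‖ ≤ B * |w b| := by
    rw [norm_mul, norm_real, Real.norm_eq_abs, mul_comm]
    exact mul_le_mul_of_nonneg_right (hB b ⟨hab, le_rfl⟩) (abs_nonneg _)
  rw [hparts, mul_add]
  exact (norm_sub_le _ _).trans (add_le_add hend hrem)

variable {ψ ψ' ψ'' : ℝ → ℝ}

theorem integral_abs_deriv_eq_sub_of_nonpos {w w' : ℝ → ℝ} (hab : a ≤ b)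
    (hw : ∀ x ∈ Set.Icc a b, HasDerivAt w (w' x) x) (hw' : ContinuousOn w' (Set.Icc a b))
    (hneg : ∀ x ∈ Set.Icc a b, w' x ≤ 0) : ∫ x in a..b, |w' x| = w a - w b := by
  rw [← Set.uIcc_of_le hab] at hw hw' hneg
  rw [intervalIntegral.integral_congr fun x hx => abs_of_nonpos (hneg x hx),
    intervalIntegral.integral_neg,
    intervalIntegral.integral_eq_sub_of_hasDerivAt hw hw'.intervalIntegrable, neg_sub]

theorem norm_integral_exp_mul_deriv_le_two (hψ : ∀ x, HasDerivAt ψ (ψ' x) x)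
    (hψ' : Continuous ψ') (a b : ℝ) : ‖∫ x in a..b, exp (ψ x * I) * (ψ' x * I)‖ ≤ 2 := by
  have hψ_cont : Continuous ψ := continuous_iff_continuousAt.2 fun x => (hψ x).continuousAt
  rw [intervalIntegral.integral_eq_sub_of_hasDerivAt
    (fun x _ => ((hψ x).ofReal_comp.mul_const I).cexp)
    (Continuous.intervalIntegrable (by fun_prop) _ _)]
  refine (norm_sub_le _ _).trans ?_
  rw [norm_exp_ofReal_mul_I, norm_exp_ofReal_mul_I]
  norm_num

theorem norm_integral_exp_le_of_le_abs_deriv {l : ℝ} (hab : a ≤ b) (hl : 0 < l)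
    (hψ : ∀ x, HasDerivAt ψ (ψ' x) x) (hψ' : ∀ x, HasDerivAt ψ' (ψ'' x) x) (hψ'' : Continuous ψ'')
    (hconvex : ∀ x ∈ Set.Icc a b, 0 ≤ ψ'' x) (hlow : ∀ x ∈ Set.Icc a b, l ≤ |ψ' x|) :
    ‖∫ x in a..b, exp (ψ x * I)‖ ≤ 6 / l := by
  have hne (x : ℝ) (hx : x ∈ Set.Icc a b) : ψ' x ≠ 0 := abs_pos.1 (hl.trans_le (hlow x hx))
  have hinv (x : ℝ) (hx : x ∈ Set.Icc a b) : |(ψ' x)⁻¹| ≤ l⁻¹ := by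
    rw [abs_inv]
    exact inv_anti₀ hl (hlow x hx)
  have hψ_cont : Continuous ψ := continuous_iff_continuousAt.2 fun x => (hψ x).continuousAt
  have hψ'_cont : Continuous ψ' := continuous_iff_continuousAt.2 fun x => (hψ' x).continuousAt
  let q : ℝ → ℝ := fun x => -ψ'' x / ψ' x ^ 2
  have hq (x : ℝ) (hx : x ∈ Set.Icc a b) : HasDerivAt (fun x => (ψ' x)⁻¹) (q x) x :=
    (hψ' x).inv (hne x hx)
  have hq_cont : ContinuousOn q (Set.Icc a b) :=
    hψ''.neg.continuousOn.div (hψ'_cont.pow 2).continuousOn fun x hx => pow_ne_zero _ (hne x hx)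
  have hvariation : ∫ x in a..b, |q x| ≤ 2 * l⁻¹ := by
    rw [integral_abs_deriv_eq_sub_of_nonpos hab hq hq_cont fun x hx =>
      div_nonpos_of_nonpos_of_nonneg (neg_nonpos.2 (hconvex x hx)) (sq_nonneg _)]
    linarith [abs_le.1 (hinv a ⟨le_rfl, hab⟩), abs_le.1 (hinv b ⟨hab, le_rfl⟩)]
  have hfactor : ∫ x in a..b, exp (ψ x * I) * (ψ' x * I) * ((ψ' x)⁻¹ : ℝ) =
      I * ∫ x in a..b, exp (ψ x * I) := by
    rw [← intervalIntegral.integral_const_mul]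
    refine intervalIntegral.integral_congr fun x hx => ?_
    have : (ψ' x : ℂ) ≠ 0 := ofReal_ne_zero.2 (hne x (Set.uIcc_of_le hab ▸ hx))
    simp only [ofReal_inv]
    field_simp
  calc ‖∫ x in a..b, exp (ψ x * I)‖
      = ‖∫ x in a..b, exp (ψ x * I) * (ψ' x * I) * ((ψ' x)⁻¹ : ℝ)‖ := by
        rw [hfactor, norm_mul, norm_I, one_mul]
    _ ≤ 2 * (|(ψ' b)⁻¹| + ∫ x in a..b, |q x|) :=
        norm_integral_mul_le_of_norm_integral_le (by fun_prop) hab hq hq_cont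
          fun x _ => norm_integral_exp_mul_deriv_le_two hψ hψ'_cont a x
    _ ≤ 2 * (l⁻¹ + 2 * l⁻¹) := by
        gcongr
        exact hinv b ⟨hab, le_rfl⟩
    _ = 6 / l := by ring

theorem exists_forall_mul_abs_sub_le_abs {f f' : ℝ → ℝ} {L : ℝ} (hab : a ≤ b)
    (hf : ∀ x ∈ Set.Icc a b, HasDerivAt f (f' x) x) (hlow : ∀ x ∈ Set.Icc a b, L ≤ f' x) :
    ∃ z, ∀ x ∈ Set.Icc a b, L * |x - z| ≤ |f x| := by
  have hcont : ContinuousOn f (Set.Icc a b) := HasDerivAt.continuousOn hf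
  have mvt {x y : ℝ} (hx : x ∈ Set.Icc a b) (hy : y ∈ Set.Icc a b) (hxy : x ≤ y) :
      L * (y - x) ≤ f y - f x := by
    refine (convex_Icc a b).mul_sub_le_image_sub_of_le_deriv hcont
      (fun x hx => (hf x (interior_subset hx)).differentiableAt.differentiableWithinAt)
      (fun x hx => ?_) x hx y hy hxy
    rw [(hf x (interior_subset hx)).deriv]
    exact hlow x (interior_subset hx)
  have ha : a ∈ Set.Icc a b := ⟨le_rfl, hab⟩
  have hb : b ∈ Set.Icc a b := ⟨hab, le_rfl⟩
  rcases le_or_gt 0 (f a) with hfa | hfa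
  · refine ⟨a, fun x hx => ?_⟩
    rw [abs_of_nonneg (sub_nonneg.2 hx.1)]
    linarith [mvt ha hx hx.1, le_abs_self (f x)]
  rcases le_or_gt (f b) 0 with hfb | hfb
  · refine ⟨b, fun x hx => ?_⟩
    rw [abs_sub_comm, abs_of_nonneg (sub_nonneg.2 hx.2)]
    linarith [mvt hx hb hx.2, neg_le_abs (f x)]
  obtain ⟨z, hz, hfz⟩ := intermediate_value_Icc hab hcont ⟨hfa.le, hfb.le⟩
  refine ⟨z, fun x hx => ?_⟩
  rcases le_total z x with h | h
  · rw [abs_of_nonneg (sub_nonneg.2 h)]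
    linarith [mvt hz hx h, le_abs_self (f x)]
  · rw [abs_sub_comm, abs_of_nonneg (sub_nonneg.2 h)]
    linarith [mvt hx hz h, neg_le_abs (f x)]

theorem norm_integral_exp_le_of_le_deriv_deriv {L : ℝ} (hab : a ≤ b) (hL : 0 < L)
    (hψ : ∀ x, HasDerivAt ψ (ψ' x) x) (hψ' : ∀ x, HasDerivAt ψ' (ψ'' x) x) (hψ'' : Continuous ψ'')
    (hlow : ∀ x ∈ Set.Icc a b, L ≤ ψ'' x) :
    ‖∫ x in a..b, exp (ψ x * I)‖ ≤ 14 / √L := by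
  have hψ_cont : Continuous ψ := continuous_iff_continuousAt.2 fun x => (hψ x).continuousAt
  obtain ⟨z, hz⟩ := exists_forall_mul_abs_sub_le_abs hab (fun x _ => hψ' x) hlow
  have havoid := norm_integral_le_of_avoid_point (g := fun x => exp (ψ x * I)) (z := z)
    (δ := (√L)⁻¹) (B := 6 / √L) (M := 1) (by fun_prop) hab (by positivity)
    (fun x => (norm_exp_ofReal_mul_I _).le) (by positivity) fun a' b' ha hab' hb hδ => ?_
  · exact havoid.trans_eq (by ring)
  have hsub : Set.Icc a' b' ⊆ Set.Icc a b := Set.Icc_subset_Icc ha hb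
  refine norm_integral_exp_le_of_le_abs_deriv hab' (Real.sqrt_pos.2 hL) hψ hψ' hψ''
    (fun x hx => hL.le.trans (hlow x (hsub hx))) fun x hx => ?_
  calc √L = L * (√L)⁻¹ := by rw [← div_eq_mul_inv, Real.div_sqrt]
    _ ≤ L * |x - z| := by gcongr; exact hδ x hx
    _ ≤ |ψ' x| := hz x (hsub hx)

theorem forall_le_or_forall_le_neg_of_le_abs {f : ℝ → ℝ} {s : Set ℝ} {L : ℝ}
    (hs : IsPreconnected s) (hL : 0 < L) (hf : ContinuousOn f s) (h : ∀ x ∈ s, L ≤ |f x|) :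
    (∀ x ∈ s, L ≤ f x) ∨ ∀ x ∈ s, f x ≤ -L := by
  by_contra! ⟨⟨x, hx, hfx⟩, y, hy, hfy⟩
  obtain ⟨z, hz, hfz⟩ := hs.intermediate_value hx hy hf
    (show (0 : ℝ) ∈ Set.Icc (f x) (f y) by grind)
  grind

theorem norm_integral_exp_le_of_le_abs_deriv_deriv {L : ℝ} (hab : a ≤ b) (hL : 0 < L)
    (hψ : ∀ x, HasDerivAt ψ (ψ' x) x) (hψ' : ∀ x, HasDerivAt ψ' (ψ'' x) x) (hψ'' : Continuous ψ'')
    (hlow : ∀ x ∈ Set.Icc a b, L ≤ |ψ'' x|) :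
    ‖∫ x in a..b, exp (ψ x * I)‖ ≤ 14 / √L := by
  rcases forall_le_or_forall_le_neg_of_le_abs isPreconnected_Icc hL hψ''.continuousOn hlow
    with hconvex | hconcave
  · exact norm_integral_exp_le_of_le_deriv_deriv hab hL hψ hψ' hψ'' hconvex
  · have hconj : ∫ x in a..b, exp ((-ψ x : ℝ) * I) =
        (starRingEnd ℂ) (∫ x in a..b, exp (ψ x * I)) := by
      simp [intervalIntegral.integral_of_le hab, ← integral_conj, ← exp_conj]
    rw [← RCLike.norm_conj, ← hconj]
    exact norm_integral_exp_le_of_le_deriv_deriv hab hL (fun x => (hψ x).neg)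
      (fun x => (hψ' x).neg) hψ''.neg fun x hx => le_neg_of_le_neg (hconcave x hx)

end OscillatoryIntegral

namespace BBM

section Phase

/-- The derivative `φ'` of the symbol of the BBM equation. -/
noncomputable def phiDeriv (ξ : ℝ) : ℝ := (1 - ξ ^ 2) / (1 + ξ ^ 2) ^ 2

/-- The second derivative `φ''` of the symbol of the BBM equation. -/
noncomputable def phiDeriv₂ (ξ : ℝ) : ℝ := 2 * (ξ * (ξ ^ 2 - 3)) / (1 + ξ ^ 2) ^ 3

/-- The zeros of `φ''`, near which the second derivative test of van der Corput fails. -/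
noncomputable def phiInflectionPoints : Finset ℝ := {0, √3, -√3}

theorem hasDerivAt_phi (ξ : ℝ) : HasDerivAt phi (phiDeriv ξ) ξ := by
  have hne : 1 + ξ ^ 2 ≠ 0 := by positivity
  refine ((hasDerivAt_id ξ).fun_div ((hasDerivAt_pow 2 ξ).const_add 1) hne).congr_deriv ?_
  simp only [phiDeriv, id]
  field_simp
  push_cast
  ring

theorem hasDerivAt_phiDeriv (ξ : ℝ) : HasDerivAt phiDeriv (phiDeriv₂ ξ) ξ := by
  have hne : (1 + ξ ^ 2) ^ 2 ≠ 0 := by positivity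
  refine (((hasDerivAt_pow 2 ξ).const_sub 1).fun_div
    (((hasDerivAt_pow 2 ξ).const_add 1).fun_pow 2) hne).congr_deriv ?_
  simp only [phiDeriv₂]
  field_simp
  push_cast
  ring

theorem continuous_phiDeriv₂ : Continuous phiDeriv₂ := by
  unfold phiDeriv₂
  exact Continuous.div (by fun_prop) (by fun_prop) fun ξ => by positivity

theorem mul_one_add_sq_le_abs_mul_sq_sub_three {ξ δ : ℝ}
    (hξ : ∀ z ∈ phiInflectionPoints, δ ≤ |ξ - z|) : δ * (1 + ξ ^ 2) ≤ |ξ * (ξ ^ 2 - 3)| := by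
  have hsq : √3 * √3 = 3 := Real.mul_self_sqrt (by norm_num)
  have hsqrt : 1 ≤ √3 := Real.one_le_sqrt.2 (by norm_num)
  wlog hξ₀ : 0 ≤ ξ generalizing ξ with H
  · have hneg : ∀ z ∈ phiInflectionPoints, -z ∈ phiInflectionPoints := by
      simp [phiInflectionPoints]
    have h := H (ξ := -ξ) (fun z hz => by rw [← abs_neg]; simpa [add_comm] using hξ _ (hneg z hz))
      (by linarith)
    rwa [neg_sq, neg_mul, abs_neg] at h
  have hzero : δ ≤ ξ := by simpa [abs_of_nonneg hξ₀] using hξ 0 (by simp [phiInflectionPoints])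
  rw [abs_mul, abs_of_nonneg hξ₀]
  rcases le_total ξ 1 with h | h
  · rw [abs_of_nonpos (by nlinarith)]
    exact mul_le_mul hzero (by nlinarith) (by positivity) hξ₀
  · calc δ * (1 + ξ ^ 2) ≤ |ξ - √3| * (ξ * (ξ + √3)) :=
          mul_le_mul (hξ (√3) (by simp [phiInflectionPoints])) (by nlinarith) (by positivity)
            (abs_nonneg _)
      _ = ξ * |(ξ - √3) * (ξ + √3)| := by
          rw [abs_mul, abs_of_nonneg (by positivity : 0 ≤ ξ + √3)]
          ring
      _ = ξ * |ξ ^ 2 - 3| := by congr 2; linear_combination -hsq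

theorem div_le_abs_phiDeriv₂ {ξ δ N : ℝ} (hN : 1 ≤ N) (hξN : |ξ| ≤ N)
    (hξ : ∀ z ∈ phiInflectionPoints, δ ≤ |ξ - z|) : δ / (2 * N ^ 4) ≤ |phiDeriv₂ ξ| := by
  have hsq : 1 + ξ ^ 2 ≤ 2 * N ^ 2 := by
    nlinarith [sq_le_sq' (neg_le_of_abs_le hξN) (le_of_abs_le hξN)]
  rw [phiDeriv₂, abs_div, abs_mul, abs_two, abs_of_pos (by positivity : 0 < (1 + ξ ^ 2) ^ 3),
    div_le_div_iff₀ (by positivity) (by positivity)]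
  calc δ * (1 + ξ ^ 2) ^ 3 = δ * (1 + ξ ^ 2) * (1 + ξ ^ 2) ^ 2 := by ring
    _ ≤ |ξ * (ξ ^ 2 - 3)| * (2 * N ^ 2) ^ 2 := by
        gcongr
        exact mul_one_add_sq_le_abs_mul_sq_sub_three hξ
    _ = _ := by ring

variable {a b N t : ℝ}

theorem norm_integral_exp_phase_le_of_avoid {δ : ℝ} (hab : a ≤ b) (hN : 1 ≤ N)
    (hsub : Set.Icc a b ⊆ Set.Icc (-N) N) (hδ : 0 < δ) (ht : N ^ 4 ≤ |t| * δ ^ 3) (x : ℝ)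
    (havoid : ∀ z ∈ phiInflectionPoints, ∀ ξ ∈ Set.Icc a b, δ ≤ |ξ - z|) :
    ‖∫ ξ in a..b, Complex.exp ((x * ξ - t * phi ξ : ℝ) * Complex.I)‖ ≤ 20 * δ := by
  have hphase (ξ : ℝ) : HasDerivAt (fun ξ => x * ξ - t * phi ξ) (x - t * phiDeriv ξ) ξ := by
    simpa using ((hasDerivAt_id' ξ).const_mul x).fun_sub ((hasDerivAt_phi ξ).const_mul t)
  have hphase' (ξ : ℝ) : HasDerivAt (fun ξ => x - t * phiDeriv ξ) (-(t * phiDeriv₂ ξ)) ξ :=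
    ((hasDerivAt_phiDeriv ξ).const_mul t).const_sub x
  have hlow (ξ : ℝ) (hξ : ξ ∈ Set.Icc a b) : (2 * δ ^ 2)⁻¹ ≤ |-(t * phiDeriv₂ ξ)| := by
    rw [abs_neg, abs_mul]
    calc (2 * δ ^ 2)⁻¹ = N ^ 4 / δ ^ 3 * (δ / (2 * N ^ 4)) := by field_simp
      _ ≤ |t| * |phiDeriv₂ ξ| := by
          gcongr
          · rwa [div_le_iff₀ (by positivity)]
          · exact div_le_abs_phiDeriv₂ hN (abs_le.2 (hsub hξ)) fun z hz => havoid z hz ξ hξ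
  refine (norm_integral_exp_le_of_le_abs_deriv_deriv hab (by positivity) hphase hphase'
    (continuous_phiDeriv₂.const_mul t).neg hlow).trans ?_
  have hsqrt : √(2 * δ ^ 2) ≤ 10 / 7 * δ := Real.sqrt_le_iff.2 ⟨by positivity, by nlinarith⟩
  rw [Real.sqrt_inv, div_inv_eq_mul]
  linarith

theorem norm_integral_exp_phase_le_of_pow_le {δ : ℝ} (hab : a ≤ b) (hN : 1 ≤ N)
    (hsub : Set.Icc a b ⊆ Set.Icc (-N) N) (hδ : 0 < δ) (ht : N ^ 4 ≤ |t| * δ ^ 3) (x : ℝ) :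
    ‖∫ ξ in a..b, Complex.exp ((x * ξ - t * phi ξ : ℝ) * Complex.I)‖ ≤ 176 * δ := by
  have hphi : Continuous phi :=
    continuous_iff_continuousAt.2 fun ξ => (hasDerivAt_phi ξ).continuousAt
  have hcard : (2 : ℝ) ^ phiInflectionPoints.card ≤ 2 ^ 3 :=
    pow_le_pow_right₀ one_le_two Finset.card_le_three
  refine (norm_integral_le_of_avoid_finset (M := 1) (by fun_prop) hab hδ.le
    (fun ξ => (Complex.norm_exp_ofReal_mul_I _).le) (by positivity : 0 ≤ 20 * δ)
    phiInflectionPoints fun a' b' ha hab' hb => norm_integral_exp_phase_le_of_avoid hab' hN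
      ((Set.Icc_subset_Icc ha hb).trans hsub) hδ ht x).trans ?_
  nlinarith

theorem norm_integral_exp_phase_le {τ : ℝ} (hτ : τ ∈ Set.Icc 0 (1 / 3)) (hab : a ≤ b)
    (hlength : b - a ≤ 2) (hN : 1 ≤ N) (hsub : Set.Icc a b ⊆ Set.Icc (-N) N) (t x : ℝ) :
    ‖∫ ξ in a..b, Complex.exp ((x * ξ - t * phi ξ : ℝ) * Complex.I)‖ ≤
      176 * (2 * N ^ 4 / (1 + |t|)) ^ τ := by
  set y := 2 * N ^ 4 / (1 + |t|) with hy
  have hy₀ : 0 < y := by positivity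
  rcases le_total 1 y with h | h
  · have htrivial := intervalIntegral.norm_integral_le_of_norm_le_const (a := a) (b := b)
      fun ξ _ => (Complex.norm_exp_ofReal_mul_I (x * ξ - t * phi ξ)).le
    rw [abs_of_nonneg (sub_nonneg.2 hab)] at htrivial
    linarith [Real.one_le_rpow h hτ.1]
  · have hcube : (y ^ (1 / 3 : ℝ)) ^ 3 = y := by
      rw [← Real.rpow_natCast, ← Real.rpow_mul hy₀.le]
      norm_num
    have ht : 1 ≤ |t| := by
      rw [hy, div_le_one (by positivity)] at h
      linarith [one_le_pow₀ (n := 4) hN]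
    have hδ : N ^ 4 ≤ |t| * (y ^ (1 / 3 : ℝ)) ^ 3 := by
      rw [hcube, hy, mul_div_assoc', le_div_iff₀ (by positivity)]
      nlinarith [pow_pos (zero_lt_one.trans_le hN) 4]
    refine (norm_integral_exp_phase_le_of_pow_le hab hN hsub (by positivity) hδ x).trans ?_
    gcongr 176 * ?_
    exact Real.rpow_le_rpow_of_exponent_ge hy₀ h hτ.2

end Phase

end BBM

section TemperateGrowth

theorem iteratedDeriv_exp_ofReal_mul_I (n : ℕ) :
    iteratedDeriv n (fun x : ℝ => Complex.exp (x * Complex.I)) =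
      fun x : ℝ => Complex.I ^ n * Complex.exp (x * Complex.I) := by
  induction n with
  | zero => simp
  | succ n ih =>
    ext x
    have h : HasDerivAt (fun x : ℝ => Complex.exp (x * Complex.I))
        (Complex.exp (x * Complex.I) * (1 * Complex.I)) x :=
      (Complex.ofRealCLM.hasDerivAt.mul_const Complex.I).cexp
    rw [iteratedDeriv_succ, ih, (h.const_mul _).deriv]
    ring

theorem hasTemperateGrowth_exp_ofReal_mul_I :
    Function.HasTemperateGrowth fun x : ℝ => Complex.exp (x * Complex.I) := by
  refine ⟨(Complex.ofRealCLM.contDiff.mul contDiff_const).cexp, fun n => ⟨0, 1, fun x => ?_⟩⟩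
  rw [norm_iteratedFDeriv_eq_norm_iteratedDeriv, iteratedDeriv_exp_ofReal_mul_I]
  simp [Complex.norm_exp_ofReal_mul_I]

end TemperateGrowth

namespace BBM

section Multiplier

open FourierTransform Real

theorem multiplier_multiplier {m n : ℝ → ℂ} (hm : m.HasTemperateGrowth) (hn : n.HasTemperateGrowth)
    (f : 𝓢'(ℝ, ℂ)) : multiplier n (multiplier m f) = multiplier (fun ξ => m ξ * n ξ) f :=
  TemperedDistribution.fourierMultiplierCLM_fourierMultiplierCLM_apply
    (hm.comp (by fun_prop)) (hn.comp (by fun_prop)) f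

theorem multiplier_sum {ι : Type*} {s : Finset ι} {m : ι → ℝ → ℂ}
    (hm : ∀ i ∈ s, (m i).HasTemperateGrowth) (f : 𝓢'(ℝ, ℂ)) :
    multiplier (fun ξ => ∑ i ∈ s, m i ξ) f = ∑ i ∈ s, multiplier (m i) f := by
  have hscale : ∀ i ∈ s, Function.HasTemperateGrowth fun ξ => m i (2 * π * ξ) :=
    fun i hi => (hm i hi).comp (by fun_prop)
  simp only [multiplier]
  rw [TemperedDistribution.fourierMultiplierCLM_sum ℂ hscale, sum_apply]

theorem lpNorm_multiplier_le {m : 𝓢(ℝ, ℂ)} {A M p r : ℝ} (hA₀ : 0 < A)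
    (hA : ∀ x : ℝ, ‖∫ ξ, Complex.exp ((x * ξ : ℝ) * Complex.I) * m ξ‖ ≤ A) (hM₀ : 0 < M)
    (hM : ∀ ξ, ‖m ξ‖ ≤ M) (hp : 2 ≤ p) (hpr : p.HolderConjugate r) (f : 𝓢'(ℝ, ℂ)) :
    lpNorm (.ofReal p) (multiplier m f) ≤
      .ofReal (A ^ (1 - 2 / p) * M ^ (2 / p)) * lpNorm (.ofReal r) f := by
  let scale : ℝ ≃L[ℝ] ℝ := .smulLeft (Units.mk0 (2 * π) two_pi_pos.ne')
  let m' : 𝓢(ℝ, ℂ) := SchwartzMap.compCLMOfContinuousLinearEquiv ℂ scale m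
  refine lpNorm_fourierMultiplierCLM_le (m := m') hA₀ (fun x => ?_) hM₀ (fun ξ => hM _) hp hpr f
  let g (ξ : ℝ) : ℂ := Complex.exp ((-x * ξ : ℝ) * Complex.I) * m ξ
  have hkernel : 𝓕 m' x = ∫ ξ, g (2 * π * ξ) := by
    rw [SchwartzMap.fourier_coe, Real.fourier_real_eq_integral_exp_smul]
    refine integral_congr_ae (.of_forall fun ξ => congrArg₂ (· * ·) ?_ rfl)
    congr 3
    ring
  rw [hkernel, Measure.integral_comp_mul_left, norm_smul]
  refine (mul_le_of_le_one_left (norm_nonneg _) ?_).trans (hA (-x))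
  rw [norm_of_nonneg (abs_nonneg _), abs_of_pos (by positivity)]
  exact inv_le_one_of_one_le₀ (by linarith [pi_gt_three])

end Multiplier

section Cutoff

variable {ρ : ℝ → ℝ}

theorem IsCutoff.eq_zero_of_notMem (hρ : IsCutoff ρ) {k : ℤ} {ξ : ℝ} (hξ : |ξ - k| < 1) {j : ℤ}
    (hj : j ∉ Finset.Icc (-1) 1) : ρ (ξ - (k + j : ℤ)) = 0 := by
  refine hρ.eq_zero _ ?_
  by_contra! h
  have hj₂ : |(j : ℝ)| < 2 := by
    calc |(j : ℝ)| = |(ξ - k) - (ξ - (k + j : ℤ))| := by congr 1; push_cast; ring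
      _ < 2 := by linarith [abs_sub (ξ - k) (ξ - (k + j : ℤ))]
  rw [Finset.mem_Icc, ← abs_le] at hj
  exact hj (Int.lt_add_one_iff.1 (by exact_mod_cast hj₂))

theorem IsCutoff.tsum_eq_sum (hρ : IsCutoff ρ) {k : ℤ} {ξ : ℝ} (hξ : |ξ - k| < 1) :
    ∑' l : ℤ, ρ (ξ - l) = ∑ j ∈ Finset.Icc (-1) 1, ρ (ξ - (k + j : ℤ)) := by
  rw [← (Equiv.addLeft k).tsum_eq]
  exact _root_.tsum_eq_sum fun j hj => hρ.eq_zero_of_notMem hξ hj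

theorem abs_sub_round_lt_one (ξ : ℝ) : |ξ - round ξ| < 1 :=
  (abs_sub_round ξ).trans_lt one_half_lt_one

theorem IsCutoff.one_le_tsum (hρ : IsCutoff ρ) (ξ : ℝ) : 1 ≤ ∑' l : ℤ, ρ (ξ - l) := by
  rw [hρ.tsum_eq_sum (abs_sub_round_lt_one ξ), ← hρ.eq_one _ (abs_sub_round ξ)]
  simpa using Finset.single_le_sum (f := fun j : ℤ => ρ (ξ - (round ξ + j : ℤ)))
    (fun j _ => (hρ.mem_Icc _).1) (by simp : (0 : ℤ) ∈ Finset.Icc (-1) 1)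

theorem IsCutoff.contDiff_tsum (hρ : IsCutoff ρ) : ContDiff ℝ ∞ fun ξ => ∑' l : ℤ, ρ (ξ - l) := by
  refine contDiff_iff_contDiffAt.2 fun ξ₀ => ?_
  have hsum : ContDiff ℝ ∞ fun ξ => ∑ j ∈ Finset.Icc (-1) 1, ρ (ξ - (round ξ₀ + j : ℤ)) :=
    ContDiff.sum fun j _ => hρ.smooth.comp (contDiff_id.sub contDiff_const)
  refine hsum.contDiffAt.congr_of_eventuallyEq ?_
  have hopen : IsOpen {ξ : ℝ | |ξ - round ξ₀| < 1} := isOpen_lt (by fun_prop) continuous_const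
  filter_upwards [hopen.mem_nhds (abs_sub_round_lt_one ξ₀)] with ξ hξ using hρ.tsum_eq_sum hξ

theorem IsCutoff.contDiff_sigma (hρ : IsCutoff ρ) (k : ℤ) : ContDiff ℝ ∞ (sigma ρ k) :=
  (hρ.smooth.comp (contDiff_id.sub contDiff_const)).mul
    (hρ.contDiff_tsum.inv fun ξ => (zero_lt_one.trans_le (hρ.one_le_tsum ξ)).ne')

theorem IsCutoff.sigma_eq_zero (hρ : IsCutoff ρ) {k : ℤ} {ξ : ℝ} (h : 1 ≤ |ξ - k|) :
    sigma ρ k ξ = 0 := by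
  rw [sigma, hρ.eq_zero _ h, zero_mul]

theorem IsCutoff.abs_sigma_le_one (hρ : IsCutoff ρ) (k : ℤ) (ξ : ℝ) : |sigma ρ k ξ| ≤ 1 := by
  have hmem := hρ.mem_Icc (ξ - k)
  have hsum := hρ.one_le_tsum ξ
  rw [sigma, abs_mul, abs_of_nonneg hmem.1, abs_of_nonneg (by positivity)]
  exact mul_le_one₀ hmem.2 (by positivity) (inv_le_one_of_one_le₀ hsum)

theorem sigma_eq_sigma_zero_sub (ρ : ℝ → ℝ) (k : ℤ) (ξ : ℝ) :
    sigma ρ k ξ = sigma ρ 0 (ξ - k) := by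
  rw [sigma, sigma, ← (Equiv.addRight k).tsum_eq fun l : ℤ => ρ (ξ - l)]
  simp [sub_sub, add_comm]

theorem IsCutoff.sigma_mul_sum (hρ : IsCutoff ρ) (k : ℤ) (ξ : ℝ) :
    sigma ρ k ξ * ∑ j ∈ Finset.Icc (-1) 1, sigma ρ (k + j) ξ = sigma ρ k ξ := by
  rcases le_or_gt 1 |ξ - k| with h | h
  · rw [hρ.sigma_eq_zero h, zero_mul]
  · simp only [sigma]
    rw [← Finset.sum_mul, ← hρ.tsum_eq_sum h,
      mul_inv_cancel₀ (zero_lt_one.trans_le (hρ.one_le_tsum ξ)).ne', mul_one]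

theorem IsCutoff.support_sigma_subset (hρ : IsCutoff ρ) (k : ℤ) :
    Function.support (sigma ρ k) ⊆ Set.Ioc (k - 1 : ℝ) (k + 1) := by
  intro ξ hξ
  have h : |ξ - k| < 1 := not_le.1 fun h => hξ (hρ.sigma_eq_zero h)
  rw [abs_lt] at h
  exact ⟨by linarith, by linarith⟩

theorem IsCutoff.hasCompactSupport_sigma (hρ : IsCutoff ρ) (k : ℤ) :
    HasCompactSupport (sigma ρ k) :=
  .of_support_subset_isCompact isCompact_Icc
    ((hρ.support_sigma_subset k).trans Set.Ioc_subset_Icc_self)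

theorem IsCutoff.continuous_deriv_sigma (hρ : IsCutoff ρ) (k : ℤ) :
    Continuous (deriv (sigma ρ k)) :=
  (hρ.contDiff_sigma k).continuous_deriv (by simp)

theorem IsCutoff.exists_abs_deriv_sigma_le (hρ : IsCutoff ρ) :
    ∃ D : ℝ, ∀ (k : ℤ) (ξ : ℝ), |deriv (sigma ρ k) ξ| ≤ D := by
  obtain ⟨D, hD⟩ := (hρ.hasCompactSupport_sigma 0).deriv.exists_bound_of_continuous
    (hρ.continuous_deriv_sigma 0)
  refine ⟨D, fun k ξ => ?_⟩
  rw [funext (sigma_eq_sigma_zero_sub ρ k), deriv_comp_sub_const]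
  exact hD _

theorem IsCutoff.hasTemperateGrowth_sigma (hρ : IsCutoff ρ) (k : ℤ) :
    Function.HasTemperateGrowth fun ξ : ℝ => (sigma ρ k ξ : ℂ) :=
  Function.Complex.hasTemperateGrowth_ofReal.comp
    ((hρ.hasCompactSupport_sigma k).hasTemperateGrowth (hρ.contDiff_sigma k))

end Cutoff

section Symbol

variable {ρ : ℝ → ℝ}

theorem hasTemperateGrowth_phi : phi.HasTemperateGrowth := by
  have h : phi = fun ξ => ξ * (1 + ‖ξ‖ ^ 2) ^ (-1 : ℝ) := by
    ext ξ
    simp [phi, Real.rpow_neg_one, div_eq_mul_inv]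
  rw [h]
  exact .mul .id' (Function.hasTemperateGrowth_one_add_norm_sq_rpow ℝ (-1))

/-- The symbol `e^{-itφ}` of the BBM group `S(t)`. -/
noncomputable def groupSymbol (t ξ : ℝ) : ℂ := Complex.exp ((-(t * phi ξ) : ℝ) * Complex.I)

theorem hasTemperateGrowth_groupSymbol (t : ℝ) : (groupSymbol t).HasTemperateGrowth :=
  hasTemperateGrowth_exp_ofReal_mul_I.comp
    (Function.HasTemperateGrowth.neg (.mul (.const t) hasTemperateGrowth_phi))

theorem group_eq_multiplier_groupSymbol (t : ℝ) : group t = multiplier (groupSymbol t) := by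
  rw [group]
  congr 1
  ext ξ
  simp [groupSymbol, mul_comm]

/-- The symbol `e^{-itφ} σ_k` of the block `□_k S(t)` of the BBM group, as a Schwartz function. -/
noncomputable def blockSymbol (hρ : IsCutoff ρ) (k : ℤ) (t : ℝ) : 𝓢(ℝ, ℂ) :=
  HasCompactSupport.toSchwartzMap (f := fun ξ => groupSymbol t ξ * sigma ρ k ξ)
    (((hρ.hasCompactSupport_sigma k).comp_left Complex.ofReal_zero).mul_left)
    ((hasTemperateGrowth_groupSymbol t).mul (hρ.hasTemperateGrowth_sigma k)).1

theorem blockSymbol_apply (hρ : IsCutoff ρ) (k : ℤ) (t ξ : ℝ) :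
    blockSymbol hρ k t ξ = groupSymbol t ξ * sigma ρ k ξ := rfl

theorem norm_blockSymbol_le_one (hρ : IsCutoff ρ) (k : ℤ) (t ξ : ℝ) :
    ‖blockSymbol hρ k t ξ‖ ≤ 1 := by
  rw [blockSymbol_apply, norm_mul, groupSymbol, Complex.norm_exp_ofReal_mul_I, one_mul,
    Complex.norm_real]
  exact hρ.abs_sigma_le_one k ξ

theorem box_group_eq_sum (hρ : IsCutoff ρ) (k : ℤ) (t : ℝ) (f : 𝓢'(ℝ, ℂ)) :
    box ρ k (group t f) =
      ∑ j ∈ Finset.Icc (-1) 1, multiplier (blockSymbol hρ k t) (box ρ (k + j) f) := by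
  have hσ := hρ.hasTemperateGrowth_sigma
  have hm := (blockSymbol hρ k t).hasTemperateGrowth
  have hblock : ∀ j ∈ Finset.Icc (-1 : ℤ) 1,
      Function.HasTemperateGrowth fun ξ => sigma ρ (k + j) ξ * blockSymbol hρ k t ξ :=
    fun j _ => (hσ (k + j)).mul hm
  simp only [box, group_eq_multiplier_groupSymbol]
  rw [multiplier_multiplier (hasTemperateGrowth_groupSymbol t) (hσ k)]
  simp only [multiplier_multiplier (hσ _) hm]
  rw [← multiplier_sum hblock]
  congr 2
  ext ξ
  have hpartition : (sigma ρ k ξ * ∑ j ∈ Finset.Icc (-1) 1, (sigma ρ (k + j) ξ : ℂ)) =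
      sigma ρ k ξ := by
    exact_mod_cast congrArg Complex.ofReal (hρ.sigma_mul_sum k ξ)
  rw [← Finset.sum_mul, blockSymbol_apply]
  linear_combination -groupSymbol t ξ * hpartition

theorem integral_exp_mul_blockSymbol (hρ : IsCutoff ρ) (k : ℤ) (t x : ℝ) :
    ∫ ξ, Complex.exp ((x * ξ : ℝ) * Complex.I) * blockSymbol hρ k t ξ =
      ∫ ξ in (k - 1 : ℝ)..(k + 1),
        Complex.exp ((x * ξ - t * phi ξ : ℝ) * Complex.I) * sigma ρ k ξ := by
  have hphase (ξ : ℝ) : Complex.exp ((x * ξ : ℝ) * Complex.I) * blockSymbol hρ k t ξ =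
      Complex.exp ((x * ξ - t * phi ξ : ℝ) * Complex.I) * sigma ρ k ξ := by
    rw [blockSymbol_apply, groupSymbol, ← mul_assoc, ← Complex.exp_add]
    congr 2
    push_cast
    ring
  simp only [hphase]
  refine (intervalIntegral.integral_eq_integral_of_support_subset fun ξ hξ => ?_).symm
  refine hρ.support_sigma_subset k fun h => hξ ?_
  simp only [h, Complex.ofReal_zero, mul_zero]

theorem norm_integral_exp_mul_blockSymbol_le (hρ : IsCutoff ρ) {D τ : ℝ}
    (hD : ∀ k ξ, |deriv (sigma ρ k) ξ| ≤ D) (hτ : τ ∈ Set.Icc 0 (1 / 3)) (k : ℤ) (t x : ℝ) :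
    ‖∫ ξ, Complex.exp ((x * ξ : ℝ) * Complex.I) * blockSymbol hρ k t ξ‖ ≤
      352 * D * (2 * (1 + |(k : ℝ)|) ^ 4 / (1 + |t|)) ^ τ := by
  have hab : (k - 1 : ℝ) ≤ k + 1 := by linarith
  have hk := abs_le.1 (le_refl |(k : ℝ)|)
  have hphi : Continuous phi := hasTemperateGrowth_phi.1.continuous
  rw [integral_exp_mul_blockSymbol]
  refine (norm_integral_mul_le_of_norm_integral_le (by fun_prop) hab
    (fun ξ _ => ((hρ.contDiff_sigma k).differentiable (by simp) ξ).hasDerivAt)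
    (hρ.continuous_deriv_sigma k).continuousOn fun ξ hξ => norm_integral_exp_phase_le hτ hξ.1
      (by linarith [hξ.2]) (le_add_of_nonneg_right (abs_nonneg (k : ℝ)))
      (Set.Icc_subset_Icc (by linarith) (by linarith [hξ.2])) t x).trans ?_
  have hvariation : ∫ ξ in (k - 1 : ℝ)..(k + 1), |deriv (sigma ρ k) ξ| ≤ 2 * D := by
    have h := intervalIntegral.norm_integral_le_of_norm_le_const (a := (k - 1 : ℝ)) (b := k + 1)
      fun ξ _ => (norm_abs_eq_norm (deriv (sigma ρ k) ξ)).trans_le (hD k ξ)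
    rw [abs_of_nonneg (by linarith)] at h
    exact (Real.le_norm_self _).trans (h.trans (by linarith))
  rw [hρ.sigma_eq_zero (by simp : 1 ≤ |(k + 1 : ℝ) - k|), abs_zero, zero_add]
  calc _ ≤ 176 * (2 * (1 + |(k : ℝ)|) ^ 4 / (1 + |t|)) ^ τ * (2 * D) := by gcongr
    _ = _ := by ring

end Symbol

end BBM

section SequenceSpace

theorem ennreal_rpow_sum_le_card_rpow_mul_sum_rpow {ι : Type*} (J : Finset ι) (a : ι → ℝ≥0∞)
    {q : ℝ} (hq : 0 < q) : (∑ j ∈ J, a j) ^ q ≤ (J.card : ℝ≥0∞) ^ q * ∑ j ∈ J, a j ^ q := by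
  rcases J.eq_empty_or_nonempty with rfl | hJ
  · simp [hq]
  obtain ⟨i, hi, hmax⟩ := J.exists_max_image a hJ
  calc (∑ j ∈ J, a j) ^ q ≤ (J.card * a i) ^ q := by
        gcongr
        simpa using J.sum_le_card_nsmul a (a i) hmax
    _ = (J.card : ℝ≥0∞) ^ q * a i ^ q := ENNReal.mul_rpow_of_nonneg _ _ hq.le
    _ ≤ _ := by
        gcongr
        exact Finset.single_le_sum (f := fun j => a j ^ q) (fun _ _ => zero_le) hi

theorem tsum_rpow_rpow_inv_le_of_le_sum_add {G : Type*} [AddGroup G] {u v : G → ℝ≥0∞} {c : ℝ≥0∞}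
    {q : ℝ} (hq : 0 < q) {J : Finset G} (h : ∀ k, v k ≤ c * ∑ j ∈ J, u (k + j)) :
    (∑' k, v k ^ q) ^ (1 / q) ≤
      c * (J.card : ℝ≥0∞) ^ (1 + 1 / q) * (∑' k, u k ^ q) ^ (1 / q) := by
  have hq' : 0 ≤ 1 / q := by positivity
  have hshift (j : G) : ∑' k, u (k + j) ^ q = ∑' k, u k ^ q :=
    (Equiv.addRight j).tsum_eq fun k => u k ^ q
  have hpow : ∑' k, v k ^ q ≤ (c * J.card) ^ q * (J.card * ∑' k, u k ^ q) := by
    calc ∑' k, v k ^ q ≤ ∑' k, c ^ q * (J.card ^ q * ∑ j ∈ J, u (k + j) ^ q) := by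
          refine ENNReal.tsum_le_tsum fun k => (ENNReal.rpow_le_rpow (h k) hq.le).trans ?_
          rw [ENNReal.mul_rpow_of_nonneg _ _ hq.le]
          gcongr
          exact ennreal_rpow_sum_le_card_rpow_mul_sum_rpow J _ hq
      _ = (c * J.card) ^ q * ∑ j ∈ J, ∑' k, u (k + j) ^ q := by
          rw [ENNReal.tsum_mul_left, ENNReal.tsum_mul_left, ENNReal.mul_rpow_of_nonneg _ _ hq.le,
            mul_assoc, Summable.tsum_finsetSum fun _ _ => ENNReal.summable]
      _ = _ := by simp only [hshift, Finset.sum_const, nsmul_eq_mul]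
  calc (∑' k, v k ^ q) ^ (1 / q) ≤ ((c * J.card) ^ q * (J.card * ∑' k, u k ^ q)) ^ (1 / q) :=
        ENNReal.rpow_le_rpow hpow hq'
    _ = c * (J.card * (J.card : ℝ≥0∞) ^ (1 / q)) * (∑' k, u k ^ q) ^ (1 / q) := by
        rw [ENNReal.mul_rpow_of_nonneg _ _ hq', ENNReal.mul_rpow_of_nonneg _ _ hq',
          ← ENNReal.rpow_mul, mul_one_div_cancel hq.ne', ENNReal.rpow_one]
        ring
    _ = _ := by rw [ENNReal.rpow_add_of_nonneg _ _ zero_le_one hq', ENNReal.rpow_one]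

theorem one_add_abs_rpow_le (s : ℝ) {x y : ℝ} (hy : |y| ≤ 1) :
    (1 + |x|) ^ s ≤ 2 ^ |s| * (1 + |x + y|) ^ s := by
  have hxy : 1 + |x| ≤ 2 * (1 + |x + y|) := by
    linarith [abs_sub_abs_le_abs_add x y, abs_nonneg (x + y)]
  have hyx : 1 + |x + y| ≤ 2 * (1 + |x|) := by linarith [abs_add_le x y, abs_nonneg x]
  rcases le_total 0 s with hs | hs
  · rw [abs_of_nonneg hs, ← Real.mul_rpow zero_le_two (by positivity)]
    exact Real.rpow_le_rpow (by positivity) hxy hs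
  · calc (1 + |x|) ^ s = 2 ^ (-s) * (2 * (1 + |x|)) ^ s := by
          rw [Real.mul_rpow zero_le_two (by positivity), ← mul_assoc, ← Real.rpow_add two_pos,
            neg_add_cancel, Real.rpow_zero, one_mul]
      _ ≤ 2 ^ |s| * (1 + |x + y|) ^ s := by
          rw [abs_of_nonpos hs]
          gcongr 2 ^ (-s) * ?_
          exact Real.rpow_le_rpow_of_nonpos (by positivity) hyx hs

end SequenceSpace

namespace BBM

section ModulationNorm

variable {ρ : ℝ → ℝ} {s a q : ℝ} {p r : ℝ≥0∞}

theorem modNorm_eq_tsum_rpow (ρ : ℝ → ℝ) (s : ℝ) (p : ℝ≥0∞) (hq : 0 < q) (f : 𝓢'(ℝ, ℂ)) :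
    modNorm ρ s p q f =
      (∑' k : ℤ, (.ofReal ((1 + |(k : ℝ)|) ^ s) * lpNorm p (box ρ k f)) ^ q) ^ (1 / q) := by
  have hweight (k : ℤ) : ENNReal.ofReal ((1 + |(k : ℝ)|) ^ (s * q)) =
      .ofReal ((1 + |(k : ℝ)|) ^ s) ^ q := by
    rw [ENNReal.ofReal_rpow_of_nonneg (by positivity) hq.le, Real.rpow_mul (by positivity)]
  simp only [modNorm, hweight, ENNReal.mul_rpow_of_nonneg _ _ hq.le]

theorem modNorm_mono (hq : 0 < q) {s₁ s₂ : ℝ} (hs : s₁ ≤ s₂) (f : 𝓢'(ℝ, ℂ)) :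
    modNorm ρ s₁ p q f ≤ modNorm ρ s₂ p q f := by
  unfold modNorm
  gcongr with k
  linarith [abs_nonneg (k : ℝ)]

theorem modNorm_le_of_lpNorm_box_le {c : ℝ} {f g : 𝓢'(ℝ, ℂ)} (hq : 0 < q) (hc : 0 ≤ c)
    (h : ∀ k : ℤ, lpNorm p (box ρ k g) ≤
      .ofReal (c * (1 + |(k : ℝ)|) ^ a) * ∑ j ∈ Finset.Icc (-1) 1, lpNorm r (box ρ (k + j) f)) :
    modNorm ρ s p q g ≤
      .ofReal (c * 2 ^ |s + a|) * 3 ^ (1 + 1 / q) * modNorm ρ (s + a) r q f := by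
  have hcard : (Finset.Icc (-1 : ℤ) 1).card = 3 := rfl
  rw [modNorm_eq_tsum_rpow ρ _ _ hq, modNorm_eq_tsum_rpow ρ _ _ hq]
  refine (tsum_rpow_rpow_inv_le_of_le_sum_add (J := Finset.Icc (-1) 1)
    (u := fun k : ℤ => .ofReal ((1 + |(k : ℝ)|) ^ (s + a)) * lpNorm r (box ρ k f))
    (c := .ofReal (c * 2 ^ |s + a|)) hq fun k => ?_).trans_eq (by simp [hcard])
  refine (mul_le_mul_right (h k) _).trans ?_
  rw [Finset.mul_sum, Finset.mul_sum, Finset.mul_sum]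
  refine Finset.sum_le_sum fun j hj => ?_
  have hj₁ : |(j : ℝ)| ≤ 1 := by exact_mod_cast abs_le.2 (Finset.mem_Icc.1 hj)
  rw [← mul_assoc, ← mul_assoc, ← ENNReal.ofReal_mul (by positivity),
    ← ENNReal.ofReal_mul (by positivity)]
  refine mul_le_mul_left (ENNReal.ofReal_le_ofReal ?_) _
  calc (1 + |(k : ℝ)|) ^ s * (c * (1 + |(k : ℝ)|) ^ a) = c * (1 + |(k : ℝ)|) ^ (s + a) := by
        rw [Real.rpow_add (by positivity)]
        ring
    _ ≤ c * (2 ^ |s + a| * (1 + |(k + j : ℝ)|) ^ (s + a)) := by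
        gcongr
        exact one_add_abs_rpow_le _ hj₁
    _ = _ := by push_cast; ring

end ModulationNorm

section DispersiveEstimate

variable {ρ : ℝ → ℝ} {p r τ : ℝ}

theorem exists_lpNorm_box_group_le (hρ : IsCutoff ρ) (hτ : τ ∈ Set.Icc 0 (1 / 3)) (hp : 2 ≤ p)
    (hpr : p.HolderConjugate r) :
    ∃ C : ℝ, 0 ≤ C ∧ ∀ (k : ℤ) (t : ℝ) (f : 𝓢'(ℝ, ℂ)), lpNorm (.ofReal p) (box ρ k (group t f)) ≤
      .ofReal (C * (1 + |t|) ^ (-(τ * (1 - 2 / p))) *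
        (1 + |(k : ℝ)|) ^ (4 * τ * (1 - 2 / p))) *
        ∑ j ∈ Finset.Icc (-1) 1, lpNorm (.ofReal r) (box ρ (k + j) f) := by
  obtain ⟨D, hD⟩ := hρ.exists_abs_deriv_sigma_le
  have hDE (k : ℤ) (ξ : ℝ) : |deriv (sigma ρ k) ξ| ≤ |D| + 1 := by
    linarith [hD k ξ, le_abs_self D]
  refine ⟨(352 * (|D| + 1) * 2 ^ τ) ^ (1 - 2 / p), by positivity, fun k t f => ?_⟩
  have hconst : (352 * (|D| + 1) * (2 * (1 + |(k : ℝ)|) ^ 4 / (1 + |t|)) ^ τ) ^ (1 - 2 / p) *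
      1 ^ (2 / p) = (352 * (|D| + 1) * 2 ^ τ) ^ (1 - 2 / p) *
        (1 + |t|) ^ (-(τ * (1 - 2 / p))) * (1 + |(k : ℝ)|) ^ (4 * τ * (1 - 2 / p)) := by
    rw [Real.one_rpow, mul_one, mul_assoc 4 τ, Real.rpow_neg (by positivity),
      Real.rpow_mul (by positivity) τ, Real.rpow_mul (by positivity) 4,
      Real.rpow_mul (by positivity) τ, ← Real.inv_rpow (by positivity),
      ← Real.mul_rpow (by positivity) (by positivity),
      ← Real.mul_rpow (by positivity) (by positivity),
      Real.div_rpow (by positivity) (by positivity), Real.mul_rpow two_pos.le (by positivity)]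
    congr 1
    rw [← Real.rpow_natCast]
    push_cast
    ring
  rw [box_group_eq_sum hρ, Finset.mul_sum, ← hconst]
  exact (lpNorm_sum_le (by simpa using hpr.lt.le) _ _).trans <| Finset.sum_le_sum fun j _ =>
    lpNorm_multiplier_le (by positivity) (norm_integral_exp_mul_blockSymbol_le hρ hDE hτ k t)
      one_pos (norm_blockSymbol_le_one hρ k t) hp hpr _

theorem exists_modNorm_group_le (hρ : IsCutoff ρ) {q : ℝ} (s : ℝ) (hτ : τ ∈ Set.Icc 0 (1 / 3))
    (hp : 2 ≤ p) (hpr : p.HolderConjugate r) (hq : 0 < q) :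
    ∃ C : ℝ≥0, ∀ (t : ℝ) (f : 𝓢'(ℝ, ℂ)), modNorm ρ s (.ofReal p) q (group t f) ≤
      C * .ofReal ((1 + |t|) ^ (-(τ * (1 - 2 / p)))) *
        modNorm ρ (s + 4 * τ * (1 - 2 / p)) (.ofReal r) q f := by
  obtain ⟨C, hC, hblock⟩ := exists_lpNorm_box_group_le hρ hτ hp hpr
  refine ⟨(C * 2 ^ |s + 4 * τ * (1 - 2 / p)|).toNNReal * 3 ^ (1 + 1 / q), fun t f => ?_⟩
  refine (modNorm_le_of_lpNorm_box_le hq (by positivity) (hblock · t f)).trans_eq ?_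
  rw [mul_right_comm C, ENNReal.ofReal_mul (by positivity), ENNReal.coe_mul,
    ENNReal.coe_rpow_of_nonneg _ (by positivity), ENNReal.coe_ofNat, ENNReal.ofReal]
  ring

end DispersiveEstimate

section DecayExponent

variable {σ : ℝ}

theorem neg_one_third_le_beta (hσ : σ < -1) : -(1 / 3) ≤ beta σ := by
  unfold beta
  split_ifs <;> rw [le_div_iff₀ (by linarith)] <;> linarith

theorem div_four_le_beta (hσ : σ < -1) : σ / 4 ≤ beta σ := by
  unfold beta
  split_ifs <;> rw [le_div_iff₀ (by linarith)] <;> nlinarith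

end DecayExponent

end BBM

theorem mainTheorem8_general (ρ : ℝ → ℝ) (hρ : BBM.IsCutoff ρ) (s σ β p p' q θ : ℝ) (hσ : σ ≤ 0)
    (hβ : max (-(1 / 3)) (σ / 4) ≤ β) (hp : 2 ≤ p) (hpp' : 1 / p + 1 / p' = 1) (hq : 0 < q)
    (hθ : θ ∈ Set.Icc (0 : ℝ) 1) :
    ∃ C : ℝ≥0, ∀ (t : ℝ) (f : 𝓢'(ℝ, ℂ)),
      BBM.modNorm ρ s (ENNReal.ofReal p) q (BBM.group t f) ≤
        C * ENNReal.ofReal ((1 + |t|) ^ (2 * θ * (1 / 2 - 1 / p) * β)) *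
          BBM.modNorm ρ (s - σ * θ) (ENNReal.ofReal p') q f := by
  have hpr : p.HolderConjugate p' :=
    Real.holderConjugate_iff.2 ⟨by linarith, by simpa [one_div] using hpp'⟩
  set γ := max (-(1 / 3)) (σ / 4)
  have hγ₀ : γ ≤ 0 := max_le (by norm_num) (by linarith)
  have hγ₁ : -(1 / 3) ≤ γ := le_max_left _ _
  have hγ₂ : σ / 4 ≤ γ := le_max_right _ _
  have hinv : 0 < 2 / p ∧ 2 / p ≤ 1 := ⟨by positivity, (div_le_one (by linarith)).2 hp⟩
  have hτ : -(θ * γ) ∈ Set.Icc 0 (1 / 3) := ⟨by nlinarith [hθ.1], by nlinarith [hθ.1, hθ.2]⟩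
  obtain ⟨C, hC⟩ := BBM.exists_modNorm_group_le hρ s hτ hp hpr hq
  refine ⟨C, fun t f => (hC t f).trans (mul_le_mul' ?_ (BBM.modNorm_mono hq ?_ f))⟩
  · gcongr C * ENNReal.ofReal ((1 + |t|) ^ ?_)
    · linarith [abs_nonneg t]
    · have hdecay := mul_le_mul_of_nonneg_left hβ (mul_nonneg hθ.1 (sub_nonneg.2 hinv.2))
      linear_combination hdecay
  · have hderivatives : 4 * -(θ * γ) ≤ -(σ * θ) := by nlinarith [hθ.1]
    nlinarith [hτ.1]

theorem mainTheorem8 (ρ : ℝ → ℝ) (hρ : BBM.IsCutoff ρ) (s σ p p' q θ : ℝ) (hσ : σ < -1)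
    (hp : 2 ≤ p) (hpp' : 1 / p + 1 / p' = 1) (hq : 0 < q) (hθ : θ ∈ Set.Icc (0 : ℝ) 1) :
    ∃ C : ℝ≥0, ∀ (t : ℝ) (f : 𝓢'(ℝ, ℂ)),
      BBM.modNorm ρ s (ENNReal.ofReal p) q (BBM.group t f) ≤
        C * ENNReal.ofReal ((1 + |t|) ^ (2 * θ * (1 / 2 - 1 / p) * BBM.beta σ)) *
          BBM.modNorm ρ (s - σ * θ) (ENNReal.ofReal p') q f :=
  mainTheorem8_general ρ hρ s σ (BBM.beta σ) p p' q θ (by linarith)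
    (max_le (BBM.neg_one_third_le_beta hσ) (BBM.div_four_le_beta hσ)) hp hpp' hq hθ
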